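/- Let $B$ be a von Neumann algebra ($W^*$-algebra) with a faithful normal tracial state $\tau$, and let $B\langle X\rangle$ be the $*$-algebra of noncommutative polynomials over $B$ in one self-adjoint indeterminate $X=X^*$. Let $\Sigma$ be the set of all linear maps $\mu:B\langle X\rangle\to B$ that are $B$-bimodular, $\mu(bPb')=b\mu(P)b'$, and completely positive, i.e. the matrix $[\mu(P_i^*P_j)]_{i,j=1}^n$ is positive in $M_n(B)$ for all $P_1,\dots,P_n\in B\langle X\rangle$. For $M>0$ let $\Sigma_{0,M}$ be the set of $\mu\in\Sigma$ with $$\|\mu(Xb_1Xb_2\cdots Xb_nX)\|\le M^{n+1}\|b_1\|\cdots\|b_n\|\qquad(n\ge 0,\ b_1,\dots,b_n\in B),$$ and let $\Sigma_0=\bigcup_{M>0}\Sigma_{0,M}$. Endow $\Sigma$ with the topology of pointwise weak convergence, in which $\mu_\lambda\to\mu$ if and only if $\mu_\lambda(P)\to\mu(P)$ in the weak-$*$ (ultraweak) topology of $B$ for every $P\in B\langle X\rangle$. Let $\Sigma_0^\tau\subset\Sigma_0$ be the set of those $\mu\in\Sigma_0$ for which there are a von Neumann algebra $A$ that contains $B$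 as a (unital) $W^*$-subalgebra, a faithful normal tracial state on $A$ that extends $\tau$, and a self-adjoint element $a\in A$ such that $\mu(P)=E_B(P(a))$ for all $P\in B\langle X\rangle$, where $E_B:A\to B$ is the trace-preserving conditional expectation. Then $\Sigma_0^\tau$ is closed in $\Sigma_0$ in the topology of pointwise weak convergence, and $\Sigma_0^\tau\cap\Sigma_{0,M}$ is compact in this topology for every $M>0$. -/

import Mathlib

open scoped Topology InnerProductSpace ComplexOrder

universe u v

/-! ### Noncommutative polynomials with coefficients in an algebra -/

/-- The relations that make the letters `some b` of the free complex algebra on `R ⊔ {X}`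
(with `X = none`) add, multiply and scale as the elements `b` of `R` do; the letter `none`, which
becomes the indeterminate `X`, is left free. -/
inductive NCPoly.Rel (R : Type u) [Ring R] [Algebra ℂ R] :
    FreeAlgebra ℂ (Option R) → FreeAlgebra ℂ (Option R) → Prop
  | add (b c : R) : NCPoly.Rel R (FreeAlgebra.ι ℂ (some (b + c)))
      (FreeAlgebra.ι ℂ (some b) + FreeAlgebra.ι ℂ (some c))
  | mul (b c : R) : NCPoly.Rel R (FreeAlgebra.ι ℂ (some (b * c)))
      (FreeAlgebra.ι ℂ (some b) * FreeAlgebra.ι ℂ (some c))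
  | scalar (z : ℂ) : NCPoly.Rel R (FreeAlgebra.ι ℂ (some (algebraMap ℂ R z)))
      (algebraMap ℂ (FreeAlgebra ℂ (Option R)) z)

/-- The algebra `R⟨X⟩` of noncommutative polynomials over `R`: the complex unital algebra
generated by `R` and one indeterminate `X` which satisfies no relation with `R` (apart from
commuting with the complex scalars). It is spanned by the monomials `b₀ X b₁ X ⋯ X bₙ`. -/
def NCPoly (R : Type u) [Ring R] [Algebra ℂ R] : Type u := RingQuot (NCPoly.Rel R)

namespace NCPoly

section basic

variable {R : Type u} [Ring R] [Algebra ℂ R]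

noncomputable instance : Ring (NCPoly R) := inferInstanceAs (Ring (RingQuot (NCPoly.Rel R)))

noncomputable instance : Algebra ℂ (NCPoly R) :=
  inferInstanceAs (Algebra ℂ (RingQuot (NCPoly.Rel R)))

/-- The quotient map from the free algebra. -/
noncomputable def mk : FreeAlgebra ℂ (Option R) →ₐ[ℂ] NCPoly R :=
  RingQuot.mkAlgHom ℂ (NCPoly.Rel R)

theorem mk_rel {x y : FreeAlgebra ℂ (Option R)} (h : NCPoly.Rel R x y) : mk x = mk y :=
  RingQuot.mkAlgHom_rel ℂ h

/-- The indeterminate. -/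
noncomputable def X : NCPoly R := mk (FreeAlgebra.ι ℂ none)

/-- The inclusion of the coefficients as constant polynomials. -/
noncomputable def C : R →ₐ[ℂ] NCPoly R :=
  AlgHom.mk'
    { toFun := fun b => mk (FreeAlgebra.ι ℂ (some b))
      map_one' := by
        have h := mk_rel (Rel.scalar (R := R) 1)
        simpa using h
      map_mul' := fun b c => by rw [mk_rel (Rel.mul b c), map_mul]
      map_zero' := by
        have h := mk_rel (Rel.scalar (R := R) 0)
        simpa using h
      map_add' := fun b c => by rw [mk_rel (Rel.add b c), map_add] }
    (fun z b => by
      have h1 : z • b = algebraMap ℂ R z * b := Algebra.smul_def z b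
      have h2 := mk_rel (Rel.scalar (R := R) z)
      simp only [RingHom.coe_mk, MonoidHom.coe_mk, OneHom.coe_mk]
      rw [h1, mk_rel (Rel.mul _ b), map_mul, h2, AlgHom.commutes, ← Algebra.smul_def])

theorem C_apply (b : R) : (C b : NCPoly R) = mk (FreeAlgebra.ι ℂ (some b)) := rfl

/-- Substitution: for a homomorphism `φ : R → S` and `a ∈ S`, the value `P(a)` of a polynomial `P`
whose coefficients are read in `S` through `φ`. -/
noncomputable def eval {S : Type v} [Ring S] [Algebra ℂ S] (φ : R →ₐ[ℂ] S) (a : S) :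
    NCPoly R →ₐ[ℂ] S :=
  RingQuot.liftAlgHom ℂ ⟨FreeAlgebra.lift ℂ (fun o => o.elim a φ), by
    intro x y h
    cases h <;> simp⟩

theorem eval_mk {S : Type v} [Ring S] [Algebra ℂ S] (φ : R →ₐ[ℂ] S) (a : S)
    (x : FreeAlgebra ℂ (Option R)) :
    eval φ a (mk x) = FreeAlgebra.lift ℂ (fun o => o.elim a φ) x :=
  RingQuot.liftAlgHom_mkAlgHom_apply ℂ _ _ _

theorem eval_X {S : Type v} [Ring S] [Algebra ℂ S] (φ : R →ₐ[ℂ] S) (a : S) :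
    eval φ a X = a := by
  simp [X, eval_mk]

theorem eval_C {S : Type v} [Ring S] [Algebra ℂ S] (φ : R →ₐ[ℂ] S) (a : S) (b : R) :
    eval φ a (C b) = φ b := by
  simp [C_apply, eval_mk]

theorem mk_surjective : Function.Surjective (mk : FreeAlgebra ℂ (Option R) →ₐ[ℂ] NCPoly R) :=
  RingQuot.mkAlgHom_surjective ℂ _

/-- Induction on polynomials: constants and `X` generate. -/
theorem induction {p : NCPoly R → Prop} (hC : ∀ b, p (C b)) (hX : p X)
    (hadd : ∀ P Q, p P → p Q → p (P + Q)) (hmul : ∀ P Q, p P → p Q → p (P * Q)) (P : NCPoly R) :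
    p P := by
  obtain ⟨x, rfl⟩ := mk_surjective P
  induction x using FreeAlgebra.induction with
  | grade0 z =>
    have h := mk_rel (Rel.scalar (R := R) z)
    rw [← h]
    exact hC _
  | grade1 o =>
    cases o with
    | none => exact hX
    | some b => exact hC b
  | mul a b ha hb => rw [map_mul]; exact hmul _ _ ha hb
  | add a b ha hb => rw [map_add]; exact hadd _ _ ha hb

/-- The monomial `X b₁ X b₂ X ⋯ X bₙ X` attached to the list `[b₁, …, bₙ]`. -/
noncomputable def monomial : List R → NCPoly R
  | [] => X
  | b :: l => X * C b * monomial l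

end basic

section star

variable {R : Type u} [Ring R] [Algebra ℂ R] [StarRing R]

/-- The value of the involution on the generators: `X ↦ X` and `b ↦ b*`. -/
noncomputable def starGen (o : Option R) : (NCPoly R)ᵐᵒᵖ :=
  o.elim (MulOpposite.op X) (fun b => MulOpposite.op (C (star b)))

/-- The conjugate-linear ring homomorphism from the free algebra to the opposite of `R⟨X⟩` that
extends `starGen`. -/
noncomputable def starPre : FreeAlgebra ℂ (Option R) →+* (NCPoly R)ᵐᵒᵖ :=
  (MonoidAlgebra.liftNCRingHom ((algebraMap ℂ (NCPoly R)ᵐᵒᵖ).comp (starRingEnd ℂ))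
    (FreeMonoid.lift starGen) (fun z _ => Algebra.commute_algebraMap_left (starRingEnd ℂ z) _)).comp
    (FreeAlgebra.equivMonoidAlgebraFreeMonoid (R := ℂ) (X := Option R)).toRingEquiv.toRingHom

theorem starPre_ι (o : Option R) : starPre (FreeAlgebra.ι ℂ o) = starGen o := by
  simp [starPre, FreeAlgebra.equivMonoidAlgebraFreeMonoid, MonoidAlgebra.of_apply]

theorem starPre_algebraMap (z : ℂ) :
    starPre (algebraMap ℂ (FreeAlgebra ℂ (Option R)) z) =
      algebraMap ℂ (NCPoly R)ᵐᵒᵖ (star z) := by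
  simp [starPre]

variable [StarModule ℂ R]

/-- The involution of `R⟨X⟩` as a ring homomorphism to the opposite ring. -/
noncomputable def starHom : NCPoly R →+* (NCPoly R)ᵐᵒᵖ :=
  RingQuot.lift ⟨starPre, by
    intro x y h
    cases h with
    | add b c => simp [starPre_ι, starGen]
    | mul b c => simp [starPre_ι, starGen]
    | scalar z =>
      rw [starPre_ι, starPre_algebraMap]
      simp only [starGen, Option.elim, ← algebraMap_star_comm, AlgHom.commutes]
      rfl⟩

theorem starHom_mk (x : FreeAlgebra ℂ (Option R)) : starHom (mk x) = starPre x := by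
  have h : (mk x : NCPoly R) = RingQuot.mkRingHom (NCPoly.Rel R) x := by
    rw [← RingQuot.mkAlgHom_coe ℂ]; rfl
  rw [h]
  exact RingQuot.lift_mkRingHom_apply _ _ _

theorem starHom_X : starHom (X : NCPoly R) = MulOpposite.op X := by
  rw [X, starHom_mk, starPre_ι]; rfl

theorem starHom_C (b : R) : starHom (C b : NCPoly R) = MulOpposite.op (C (star b)) := by
  rw [C_apply, starHom_mk, starPre_ι]; rfl

/-- The involution of `R⟨X⟩`: the conjugate-linear antimultiplicative involution which extends the
one of `R` and fixes `X`, so `(b₀ X b₁ ⋯ X bₙ)* = bₙ* X ⋯ b₁* X b₀*`. -/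
noncomputable instance : StarRing (NCPoly R) where
  star P := (starHom P).unop
  star_involutive P := by
    induction P using NCPoly.induction with
    | hC b => simp [starHom_C]
    | hX => simp [starHom_X]
    | hadd P Q hP hQ => simp only [map_add, MulOpposite.unop_add, hP, hQ]
    | hmul P Q hP hQ => simp only [map_mul, MulOpposite.unop_mul, hP, hQ]
  star_mul P Q := by simp
  star_add P Q := by simp

theorem star_X : star (X : NCPoly R) = X := congrArg MulOpposite.unop starHom_X

theorem star_C (b : R) : star (C b : NCPoly R) = C (star b) :=
  congrArg MulOpposite.unop (starHom_C b)

end star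

end NCPoly

/-! ### Von Neumann algebras: the weak-* topology, traces -/

section vonNeumann

/-- A von Neumann algebra is closed under complex scalars. -/
instance VonNeumannAlgebra.instSMulMemClass {H : Type u} [NormedAddCommGroup H]
    [InnerProductSpace ℂ H] [CompleteSpace H] :
    SMulMemClass (VonNeumannAlgebra H) ℂ (H →L[ℂ] H) where
  smul_mem {S} c _ hx := S.toStarSubalgebra.smul_mem hx c

variable {H : Type u} [NormedAddCommGroup H] [InnerProductSpace ℂ H] [CompleteSpace H]

/-- The weak-* topology of the von Neumann algebra `B` (the ultraweak, or σ-weak, topology): the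
coarsest topology that makes continuous all functionals `b ↦ ∑ₙ ⟨ηₙ, b ξₙ⟩` given by
square-summable sequences `ξ`, `η` in the Hilbert space. -/
@[reducible] noncomputable def VonNeumannAlgebra.ultraweak (B : VonNeumannAlgebra H) : TopologicalSpace B :=
  ⨅ (ξ : ℕ → H) (η : ℕ → H) (_ : Summable fun n => ‖ξ n‖ ^ 2) (_ : Summable fun n => ‖η n‖ ^ 2),
    TopologicalSpace.induced (fun b : B => ∑' n, ⟪η n, (b : H →L[ℂ] H) (ξ n)⟫_ℂ) inferInstance

/-- `τ` is a faithful normal tracial state on the von Neumann algebra `B`; the pair `(B, τ)` is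
then a tracial von Neumann algebra. -/
structure IsFaithfulNormalTrace (B : VonNeumannAlgebra H) (τ : B →ₗ[ℂ] ℂ) : Prop where
  map_one : τ 1 = 1
  nonneg : ∀ x : B, 0 ≤ τ (star x * x)
  faithful : ∀ x : B, τ (star x * x) = 0 → x = 0
  tracial : ∀ x y : B, τ (x * y) = τ (y * x)
  normal : @Continuous B ℂ B.ultraweak _ τ

end vonNeumann

/-! ### `B`-valued distributions -/

section distributions

variable {H : Type u} [NormedAddCommGroup H] [InnerProductSpace ℂ H] [CompleteSpace H]

/-- The space `Σ` of all `B`-bimodular completely positive maps `μ : B⟨X⟩ → B`. The matrix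
`(μ(Pᵢ* Pⱼ))ᵢⱼ` in `Mₙ(B)` is positive as an operator on the Hilbert space `Hⁿ`. -/
structure BDist (B : VonNeumannAlgebra H) where
  /-- The underlying linear map. -/
  toMap : NCPoly B →ₗ[ℂ] B
  bimodular : ∀ (b c : B) (P : NCPoly B),
    toMap (NCPoly.C b * P * NCPoly.C c) = b * toMap P * c
  completelyPositive : ∀ (n : ℕ) (P : Fin n → NCPoly B) (ξ : Fin n → H),
    0 ≤ ∑ i, ∑ j, ⟪ξ i, (toMap (star (P i) * P j) : H →L[ℂ] H) (ξ j)⟫_ℂ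

/-- The topology of pointwise weak convergence on `Σ`: the coarsest one for which all the maps
`μ ↦ μ(P)` are continuous into `B` with its weak-* topology. -/
noncomputable instance BDist.instTopologicalSpace (B : VonNeumannAlgebra H) : TopologicalSpace (BDist B) :=
  ⨅ P : NCPoly B, TopologicalSpace.induced (fun μ : BDist B => μ.toMap P) B.ultraweak

/-- `Σ_{0,M}`: the elements of `Σ` that are exponentially bounded by `M`, that is,
`‖μ(X b₁ X ⋯ X bₙ X)‖ ≤ M ^ (n + 1) ‖b₁‖ ⋯ ‖bₙ‖` for all `n ≥ 0` and `b₁, …, bₙ ∈ B`. -/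
def BDist.expBounded (B : VonNeumannAlgebra H) (M : ℝ) : Set (BDist B) :=
  {μ | ∀ l : List B, ‖μ.toMap (NCPoly.monomial l)‖ ≤ M ^ (l.length + 1) * (l.map norm).prod}

/-- `Σ₀`: the exponentially bounded elements of `Σ`. -/
def BDist.sigmaZero (B : VonNeumannAlgebra H) : Set (BDist B) :=
  {μ | ∃ M : ℝ, μ ∈ BDist.expBounded B M}

/-- A tracial W*-probability space `(A, E_B, B)` over the tracial von Neumann algebra `(B, τ)`:
a von Neumann algebra `A` with a faithful normal tracial state `τA`, which contains `B` as a
W*-subalgebra through `incl`, with `τA` extending `τ`, and the `τA`-preserving conditional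
expectation `E : A → B` (which is unique). -/
structure TracialProbSpace (B : VonNeumannAlgebra H) (τ : B →ₗ[ℂ] ℂ) where
  /-- The Hilbert space on which `A` acts. -/
  K : Type u
  [normed : NormedAddCommGroup K]
  [inner : InnerProductSpace ℂ K]
  [complete : CompleteSpace K]
  /-- The larger algebra. -/
  A : VonNeumannAlgebra K
  /-- The trace of the larger algebra. -/
  τA : A →ₗ[ℂ] ℂ
  isTrace : IsFaithfulNormalTrace A τA
  /-- The inclusion of `B` in `A`, a unital *-homomorphism. -/
  incl : B →⋆ₐ[ℂ] A
  incl_injective : Function.Injective incl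
  /-- The inclusion is normal; for a bounded linear map it suffices to require weak-* continuity
  on the unit ball. -/
  incl_normal : @ContinuousOn B A B.ultraweak A.ultraweak incl {b | ‖b‖ ≤ 1}
  trace_incl : ∀ b : B, τA (incl b) = τ b
  /-- The conditional expectation. -/
  E : A →ₗ[ℂ] B
  E_incl : ∀ b : B, E (incl b) = b
  E_bimodular : ∀ (b c : B) (x : A), E (incl b * x * incl c) = b * E x * c
  E_positive : ∀ (x : A) (ξ : H), 0 ≤ ⟪ξ, (E (star x * x) : H →L[ℂ] H) ξ⟫_ℂ
  trace_E : ∀ x : A, τ (E x) = τA x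

attribute [instance] TracialProbSpace.normed TracialProbSpace.inner TracialProbSpace.complete

/-- `Σ₀^τ`: the elements `μ` of `Σ₀` that are the `B`-valued distribution `P ↦ E_B(P(a))` of a
self-adjoint element `a` of a tracial W*-probability space `(A, E_B, B)` over `(B, τ)`. -/
def BDist.sigmaTau (B : VonNeumannAlgebra H) (τ : B →ₗ[ℂ] ℂ) : Set (BDist B) :=
  {μ | μ ∈ BDist.sigmaZero B ∧ ∃ (S : TracialProbSpace B τ) (a : S.A), IsSelfAdjoint a ∧
    ∀ P : NCPoly B, μ.toMap P = S.E (NCPoly.eval S.incl.toAlgHom a P)}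

end distributions

/-! Everything rests on an intrinsic description (`mem_sigmaTau_iff`): an element `μ` of `Σ₀` lies
in `Σ₀^τ` exactly when `μ(1) = 1` and `τ ∘ μ` is a trace on polynomials. Since `τ` is normal, both
conditions pass to pointwise weak limits (`tracial_of_tendsto`), which gives closedness. For
compactness, a unital `μ` in `Σ_{0,M}` satisfies `‖μ(P)‖ ≤ K` with `K` depending only on `P` and
`M`; Banach–Alaoglu in `B` then gives a pointwise limit along every ultrafilter, and linearity,
bimodularity, positivity and the bounds survive in the limit.

The substance is the construction of `(A, E, a)` from a tracial `τ ∘ μ`. In the GNS space of `τ ∘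
μ`, left multiplication by `X` is bounded: Cauchy–Schwarz makes the moments `τ(μ(Q* X^(2k) Q))`
log-convex in `k`, and their growth is at most `M^(2k)`. Traciality bounds right multiplications as
well; `A` is their commutant, and the vector of `1` defines a faithful normal trace on it. The
matrix coefficients of `B` on the dense vectors are `τ(μ(P Q*) ·)`, so `B` sits normally in `A`.

The conditional expectation comes from the duality between `B` and the trace norm: `b ↦ τA(x b)` is
bounded by `‖x‖ τ(|b|)`, hence equals `τ(h ·)` with `h ∈ B`, `‖h‖ ≤ ‖x‖`, by Hahn–Banach and
ultraweak compactness. Comparing traces against `B` gives `E(P(a)) = μ(P)`. -/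

/-! ### Ultraweak convergence and compactness of bounded sets -/

section ultraweakConvergence

open Filter

variable {H : Type u} [NormedAddCommGroup H] [InnerProductSpace ℂ H] [CompleteSpace H]

namespace VonNeumannAlgebra

variable {B : VonNeumannAlgebra H} {ι : Type*}

/-- Ultraweak convergence of a family in a von Neumann algebra along a filter. -/
def UWTendsto (B : VonNeumannAlgebra H) (f : ι → B) (l : Filter ι) (b : B) : Prop :=
  Tendsto f l (@nhds B B.ultraweak b)

theorem uwTendsto_iff {f : ι → B} {l : Filter ι} {b : B} :
    B.UWTendsto f l b ↔ ∀ ξ η : ℕ → H, (Summable fun n => ‖ξ n‖ ^ 2) →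
      (Summable fun n => ‖η n‖ ^ 2) →
      Tendsto (fun i => ∑' n, ⟪η n, (f i : H →L[ℂ] H) (ξ n)⟫_ℂ) l
        (𝓝 (∑' n, ⟪η n, (b : H →L[ℂ] H) (ξ n)⟫_ℂ)) := by
  unfold UWTendsto ultraweak
  simp only [nhds_iInf, nhds_induced, tendsto_iInf, tendsto_comap_iff]
  rfl

theorem summable_norm_sq_single {E : Type*} [NormedAddCommGroup E] (ξ : E) :
    Summable fun n : ℕ => ‖(Pi.single 0 ξ : ℕ → E) n‖ ^ 2 := by
  apply summable_of_ne_finset_zero (s := {0})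
  intro n hn
  simp at hn
  simp [hn]

theorem UWTendsto.inner {f : ι → B} {l : Filter ι} {b : B} (h : B.UWTendsto f l b) (ξ η : H) :
    Tendsto (fun i => ⟪η, (f i : H →L[ℂ] H) ξ⟫_ℂ) l (𝓝 ⟪η, (b : H →L[ℂ] H) ξ⟫_ℂ) := by
  have key : ∀ c : B, ∑' n : ℕ, ⟪(Pi.single 0 η : ℕ → H) n,
      (c : H →L[ℂ] H) ((Pi.single 0 ξ : ℕ → H) n)⟫_ℂ = ⟪η, (c : H →L[ℂ] H) ξ⟫_ℂ := by
    intro c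
    rw [tsum_eq_single 0]
    · simp
    · intro n hn
      simp [hn]
  simpa only [key] using uwTendsto_iff.1 h _ _ (summable_norm_sq_single ξ)
    (summable_norm_sq_single η)

theorem summable_mul_of_sq {a b : ℕ → ℝ} (ha : Summable fun n => a n ^ 2)
    (hb : Summable fun n => b n ^ 2) (ha0 : ∀ n, 0 ≤ a n) (hb0 : ∀ n, 0 ≤ b n) :
    Summable fun n => a n * b n := by
  refine Summable.of_nonneg_of_le (fun n => mul_nonneg (ha0 n) (hb0 n)) (fun n => ?_) (ha.add hb)
  nlinarith [sq_nonneg (a n - b n), sq_nonneg (a n), sq_nonneg (b n)]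

/-- On bounded sets, the ultraweak topology is the weak operator topology. -/
theorem uwTendsto_of_bounded {f : ι → B} {l : Filter ι} {b : B} {C : ℝ}
    (hf : ∀ᶠ i in l, ‖f i‖ ≤ C)
    (h : ∀ ξ η : H, Tendsto (fun i => ⟪η, (f i : H →L[ℂ] H) ξ⟫_ℂ) l
      (𝓝 ⟪η, (b : H →L[ℂ] H) ξ⟫_ℂ)) : B.UWTendsto f l b := by
  rw [uwTendsto_iff]
  intro ξ η hξ hη
  refine tendsto_tsum_of_dominated_convergence (bound := fun n => C * (‖η n‖ * ‖ξ n‖))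
    ((summable_mul_of_sq hη hξ (fun _ => norm_nonneg _) (fun _ => norm_nonneg _)).mul_left C)
    (fun n => h _ _) ?_
  filter_upwards [hf] with i hi n
  calc ‖⟪η n, (f i : H →L[ℂ] H) (ξ n)⟫_ℂ‖ ≤ ‖η n‖ * ‖(f i : H →L[ℂ] H) (ξ n)‖ :=
        norm_inner_le_norm _ _
    _ ≤ ‖η n‖ * (C * ‖ξ n‖) := by
        gcongr
        exact (f i : H →L[ℂ] H).le_of_opNorm_le hi _
    _ = _ := by ring

theorem coe_ext_inner {a b : B}
    (h : ∀ ξ η : H, ⟪η, (a : H →L[ℂ] H) ξ⟫_ℂ = ⟪η, (b : H →L[ℂ] H) ξ⟫_ℂ) : a = b :=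
  Subtype.ext (ContinuousLinearMap.ext fun ξ => ext_inner_left ℂ fun η => h ξ η)

theorem UWTendsto.unique {f : ι → B} {l : Filter ι} [l.NeBot] {a b : B}
    (ha : B.UWTendsto f l a) (hb : B.UWTendsto f l b) : a = b :=
  coe_ext_inner fun ξ η => tendsto_nhds_unique (ha.inner ξ η) (hb.inner ξ η)

theorem uwTendsto_const (l : Filter ι) (b : B) : B.UWTendsto (fun _ => b) l b :=
  uwTendsto_iff.2 fun _ _ _ _ => tendsto_const_nhds

theorem UWTendsto.congr {f g : ι → B} {l : Filter ι} {b : B} (h : B.UWTendsto f l b)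
    (hfg : f =ᶠ[l] g) : B.UWTendsto g l b :=
  Tendsto.congr' hfg h

theorem uwTendsto_of_ultrafilter {f : ι → B} {l : Filter ι} {b : B}
    (h : ∀ F : Ultrafilter ι, (F : Filter ι) ≤ l → B.UWTendsto f F b) : B.UWTendsto f l b :=
  (tendsto_iff_ultrafilter _ _ _).2 h

theorem UWTendsto.mono_left {f : ι → B} {l l' : Filter ι} {b : B} (h : B.UWTendsto f l b)
    (hl : l' ≤ l) : B.UWTendsto f l' b :=
  Tendsto.mono_left h hl

theorem UWTendsto.mul_left {f : ι → B} {l : Filter ι} {b : B} (h : B.UWTendsto f l b) (c : B) :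
    B.UWTendsto (fun i => c * f i) l (c * b) := by
  rw [uwTendsto_iff] at h ⊢
  intro ξ η hξ hη
  have key : ∀ (x : B) (n : ℕ), ⟪η n, ((c * x : B) : H →L[ℂ] H) (ξ n)⟫_ℂ =
      ⟪(star (c : H →L[ℂ] H)) (η n), (x : H →L[ℂ] H) (ξ n)⟫_ℂ := by
    intro x n
    rw [ContinuousLinearMap.star_eq_adjoint, ContinuousLinearMap.adjoint_inner_left]
    rfl
  simp only [key]
  refine h _ _ hξ ?_
  refine Summable.of_nonneg_of_le (fun n => by positivity) (fun n => ?_)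
    (hη.mul_left (‖star (c : H →L[ℂ] H)‖ ^ 2))
  rw [← mul_pow]
  gcongr
  exact ContinuousLinearMap.le_opNorm _ _

theorem UWTendsto.mul_right {f : ι → B} {l : Filter ι} {b : B} (h : B.UWTendsto f l b) (c : B) :
    B.UWTendsto (fun i => f i * c) l (b * c) := by
  rw [uwTendsto_iff] at h ⊢
  intro ξ η hξ hη
  refine h (fun n => (c : H →L[ℂ] H) (ξ n)) η ?_ hη
  refine Summable.of_nonneg_of_le (fun n => by positivity) (fun n => ?_)
    (hξ.mul_left (‖(c : H →L[ℂ] H)‖ ^ 2))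
  rw [← mul_pow]
  gcongr
  exact ContinuousLinearMap.le_opNorm _ _

/-- Ultrafilter form of the Banach–Alaoglu theorem for von Neumann algebras. -/
theorem exists_uwTendsto_of_bounded {f : ι → B} (F : Ultrafilter ι) {C : ℝ}
    (hf : ∀ᶠ i in (F : Filter ι), ‖f i‖ ≤ C) :
    ∃ b : B, ‖b‖ ≤ C ∧ B.UWTendsto f F b := by
  have hC : 0 ≤ C := by
    obtain ⟨i, hi⟩ := hf.exists
    exact (norm_nonneg _).trans hi
  have hbd : ∀ i, ‖f i‖ ≤ C → ∀ ξ η : H, ‖⟪η, (f i : H →L[ℂ] H) ξ⟫_ℂ‖ ≤ C * ‖η‖ * ‖ξ‖ := by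
    intro i hi ξ η
    calc _ ≤ ‖η‖ * ‖(f i : H →L[ℂ] H) ξ‖ := norm_inner_le_norm _ _
      _ ≤ ‖η‖ * (C * ‖ξ‖) := by
        gcongr
        exact (f i : H →L[ℂ] H).le_of_opNorm_le hi _
      _ = _ := by ring
  have hlim : ∀ ξ η : H, ∃ z : ℂ,
      Tendsto (fun i => ⟪η, (f i : H →L[ℂ] H) ξ⟫_ℂ) F (𝓝 z) := by
    intro ξ η
    obtain ⟨z, -, hz⟩ := (isCompact_closedBall (0 : ℂ) (C * ‖η‖ * ‖ξ‖)).ultrafilter_le_nhds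
      (F.map fun i => ⟪η, (f i : H →L[ℂ] H) ξ⟫_ℂ) (by
        rw [le_principal_iff, Ultrafilter.coe_map, mem_map]
        filter_upwards [hf] with i hi
        simpa using hbd i hi ξ η)
    exact ⟨z, hz⟩
  choose s hs using hlim
  have hs_norm : ∀ ξ η, ‖s ξ η‖ ≤ C * ‖η‖ * ‖ξ‖ := fun ξ η =>
    le_of_tendsto (hs ξ η).norm (hf.mono fun i hi => hbd i hi ξ η)
  -- The limits of the matrix coefficients form a bounded sesquilinear form. The operator attached
  -- to it acts on the left argument of the inner product, so its adjoint is the limit operator.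
  let S : H →ₗ⋆[ℂ] H →ₗ[ℂ] ℂ := LinearMap.mk₂'ₛₗ (starRingEnd ℂ) (RingHom.id ℂ)
    (fun η ξ => s ξ η)
    (fun η η' ξ => tendsto_nhds_unique (hs _ _) (by
      simpa only [inner_add_left] using (hs ξ η).add (hs ξ η')))
    (fun c η ξ => tendsto_nhds_unique (hs _ _) (by
      simpa only [inner_smul_left, smul_eq_mul] using (hs ξ η).const_mul _))
    (fun η ξ ξ' => tendsto_nhds_unique (hs _ _) (by
      simpa only [inner_add_right, map_add] using (hs ξ η).add (hs ξ' η)))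
    (fun c η ξ => tendsto_nhds_unique (hs _ _) (by
      simpa only [inner_smul_right, map_smul, smul_eq_mul, RingHom.id_apply] using
        (hs ξ η).const_mul c))
  let T : H →L[ℂ] H := star (InnerProductSpace.continuousLinearMapOfBilin
    (S.mkContinuous₂ C fun η ξ => hs_norm ξ η))
  have hT : ∀ ξ η, ⟪η, T ξ⟫_ℂ = s ξ η := by
    intro ξ η
    simp only [T, ContinuousLinearMap.star_eq_adjoint, ContinuousLinearMap.adjoint_inner_right]
    rw [InnerProductSpace.continuousLinearMapOfBilin_apply]
    rfl
  -- Commuting with a fixed element of the commutant is preserved in the limit; the bicommutant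
  -- property concludes.
  have hTB : T ∈ B := by
    rw [← SetLike.mem_coe, ← B.centralizer_centralizer]
    intro c hc
    refine ContinuousLinearMap.ext fun ξ => ext_inner_left ℂ fun η => ?_
    change ⟪η, c (T ξ)⟫_ℂ = ⟪η, T (c ξ)⟫_ℂ
    rw [← ContinuousLinearMap.adjoint_inner_left, hT, hT]
    refine tendsto_nhds_unique (hs _ _) ((hs (c ξ) η).congr fun i => ?_)
    rw [ContinuousLinearMap.adjoint_inner_left]
    exact congrArg (fun x : H →L[ℂ] H => ⟪η, x ξ⟫_ℂ) (hc _ (f i).2)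
  refine ⟨⟨T, hTB⟩, ?_, uwTendsto_of_bounded hf fun ξ η => by simpa only [hT] using hs ξ η⟩
  refine ContinuousLinearMap.opNorm_le_bound _ hC fun ξ => ?_
  by_cases h0 : ‖T ξ‖ = 0
  · change ‖T ξ‖ ≤ _
    rw [h0]; positivity
  · have h1 : ‖T ξ‖ * ‖T ξ‖ ≤ C * ‖ξ‖ * ‖T ξ‖ := by
      have := hs_norm ξ (T ξ)
      rw [← hT, inner_self_eq_norm_sq_to_K, norm_pow, RCLike.norm_ofReal, abs_norm, sq] at this
      linarith
    exact le_of_mul_le_mul_right h1 (lt_of_le_of_ne (norm_nonneg _) (Ne.symm h0))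

end VonNeumannAlgebra

end ultraweakConvergence

/-! ### Square roots and positivity of the trace -/

section positivity

open Filter
open scoped NNReal

variable {H : Type u} [NormedAddCommGroup H] [InnerProductSpace ℂ H] [CompleteSpace H]

namespace VonNeumannAlgebra

variable {B : VonNeumannAlgebra H}

theorem mem_of_forall_commute {x : H →L[ℂ] H}
    (h : ∀ c : H →L[ℂ] H, (∀ b ∈ B, Commute b c) → Commute x c) : x ∈ B := by
  rw [← SetLike.mem_coe, ← B.centralizer_centralizer]
  intro c hc
  exact (h c fun b hb => hc b hb).eq.symm

/-- Whatever commutes with `x` commutes with its functional calculus, so the bicommutant property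
applies. -/
theorem cfc_nnreal_mem {x : H →L[ℂ] H} (hx : x ∈ B) (f : ℝ≥0 → ℝ≥0) : cfc f x ∈ B :=
  mem_of_forall_commute fun _ hc => (hc x hx).cfc_nnreal f

theorem rpow_mem {x : H →L[ℂ] H} (hx : x ∈ B) (y : ℝ) : x ^ y ∈ B :=
  cfc_nnreal_mem hx _

/-- A positive operator in a von Neumann algebra has a self-adjoint square root there. -/
theorem exists_sqrt {x : B} (hx : (0 : H →L[ℂ] H) ≤ x) : ∃ c : B, star c = c ∧ c * c = x := by
  refine ⟨⟨CFC.sqrt (x : H →L[ℂ] H), ?_⟩, ?_, ?_⟩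
  · rw [CFC.sqrt_eq_cfc]
    exact cfc_nnreal_mem x.2 _
  · exact Subtype.ext (IsSelfAdjoint.of_nonneg (CFC.sqrt_nonneg _)).star_eq
  · exact Subtype.ext (CFC.sqrt_mul_sqrt_self _ hx)

omit [CompleteSpace H] in
theorem nonneg_of_inner {x : H →L[ℂ] H} (h : ∀ ξ : H, 0 ≤ ⟪ξ, x ξ⟫_ℂ) : 0 ≤ x := by
  rw [ContinuousLinearMap.nonneg_iff_isPositive, ContinuousLinearMap.isPositive_iff_complex]
  intro ξ
  obtain ⟨h1, h2⟩ := Complex.nonneg_iff.1 (h ξ)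
  have e : ⟪x ξ, ξ⟫_ℂ = ⟪ξ, x ξ⟫_ℂ :=
    (inner_conj_symm (x ξ) ξ).symm.trans (Complex.conj_eq_iff_im.2 h2.symm)
  rw [e]
  exact ⟨Complex.ext rfl (by simpa using h2), h1⟩

end VonNeumannAlgebra

namespace IsFaithfulNormalTrace

variable {B : VonNeumannAlgebra H} {τ : B →ₗ[ℂ] ℂ}

theorem tendsto (hτ : IsFaithfulNormalTrace B τ) {ι : Type*} {f : ι → B} {l : Filter ι} {b : B}
    (h : B.UWTendsto f l b) : Tendsto (fun i => τ (f i)) l (𝓝 (τ b)) :=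
  (@Continuous.tendsto B ℂ B.ultraweak _ _ hτ.normal b).comp h

theorem nonneg_of_nonneg (hτ : IsFaithfulNormalTrace B τ) {x : B}
    (hx : (0 : H →L[ℂ] H) ≤ x) : 0 ≤ τ x := by
  obtain ⟨c, hc, rfl⟩ := VonNeumannAlgebra.exists_sqrt hx
  simpa only [hc] using hτ.nonneg c

/-- The trace pairing is nondegenerate: test with `b = (x - y)*`. The algebraic identities of the
conditional expectation are checked through it. -/
theorem eq_of_forall_mul (hτ : IsFaithfulNormalTrace B τ) {x y : B}
    (h : ∀ b, τ (x * b) = τ (y * b)) : x = y := by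
  rw [← sub_eq_zero, ← star_eq_zero]
  apply hτ.faithful
  rw [star_star, sub_mul, map_sub, h, sub_self]

theorem le_norm (hτ : IsFaithfulNormalTrace B τ) {x : B} (hx : star x = x) :
    τ x ≤ (‖x‖ : ℂ) := by
  have h : (0 : H →L[ℂ] H) ≤ ((‖x‖ : ℂ) • (1 : B) - x : B) := by
    have h1 : IsSelfAdjoint (x : H →L[ℂ] H) := congrArg Subtype.val hx
    have h2 := h1.le_algebraMap_norm_self
    rw [Algebra.algebraMap_eq_smul_one] at h2
    have h3 := sub_nonneg.2 h2
    exact h3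
  have h4 := hτ.nonneg_of_nonneg h
  simp only [map_sub, map_smul, hτ.map_one, smul_eq_mul, mul_one, sub_nonneg] at h4
  exact h4

end IsFaithfulNormalTrace

end positivity

/-! ### Trace-norm duality and values of the conditional expectation -/

section conditionalExpectation

open Filter

variable {H : Type u} [NormedAddCommGroup H] [InnerProductSpace ℂ H] [CompleteSpace H]
variable {B : VonNeumannAlgebra H} {τ : B →ₗ[ℂ] ℂ}

/-- The elements `(b* b + ε) ^ (1/4)` and `(b* b + ε) ^ (-1/4)` of a von Neumann algebra. -/
theorem VonNeumannAlgebra.exists_fourth_root (b : B) {ε : ℝ} (hε : 0 < ε) :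
    ∃ g g' : B, star g = g ∧ star g' = g' ∧ g * g' = 1 ∧ g' * g = 1 ∧
      g * g * (g * g) = star b * b + (ε : ℂ) • (1 : B) := by
  set a : H →L[ℂ] H := star (b : H →L[ℂ] H) * b + algebraMap ℝ (H →L[ℂ] H) ε with ha
  have haB : a ∈ B := by
    have : a = ((star b * b + (ε : ℂ) • (1 : B) : B) : H →L[ℂ] H) := by
      rw [ha, Algebra.algebraMap_eq_smul_one]; rfl
    rw [this]; exact Subtype.property _
  -- The shift by `ε` makes `a` invertible, so that negative powers exist and exponents add.
  have hpos : IsStrictlyPositive a :=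
    IsStrictlyPositive.nonneg_add (star_mul_self_nonneg _) (isStrictlyPositive_algebraMap hε)
  have hadd : ∀ x y : ℝ, a ^ (x + y) = a ^ x * a ^ y := fun x y => CFC.rpow_add hpos.isUnit
  refine ⟨⟨a ^ (1 / 4 : ℝ), VonNeumannAlgebra.rpow_mem haB _⟩,
    ⟨a ^ (-(1 / 4) : ℝ), VonNeumannAlgebra.rpow_mem haB _⟩,
    Subtype.ext (IsSelfAdjoint.of_nonneg CFC.rpow_nonneg).star_eq,
    Subtype.ext (IsSelfAdjoint.of_nonneg CFC.rpow_nonneg).star_eq,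
    Subtype.ext (CFC.rpow_mul_rpow_neg _ hpos), Subtype.ext (CFC.rpow_neg_mul_rpow _ hpos),
    Subtype.ext ?_⟩
  change a ^ (1 / 4 : ℝ) * a ^ (1 / 4 : ℝ) * (a ^ (1 / 4 : ℝ) * a ^ (1 / 4 : ℝ)) = _
  rw [← hadd, ← hadd]
  norm_num
  rw [CFC.rpow_one a hpos.nonneg, ha, Algebra.algebraMap_eq_smul_one]

namespace IsFaithfulNormalTrace

/-- A regularized polar decomposition: `h = (b* b + ε) ^ (-1/2) b*` is a contraction, and `τ(h b)`
approximates `τ(|b|)`. -/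
theorem exists_contraction (hτ : IsFaithfulNormalTrace B τ) (b : B) {δ : ℝ} (hδ : 0 < δ) :
    ∃ (h g g' : B) (t s : ℝ), ‖h‖ ≤ 1 ∧ g' * g = 1 ∧ τ (h * b) = t ∧
      τ (star (b * g') * (b * g')) = t ∧ τ (star g * g) = s ∧ s ≤ t + δ := by
  -- With `ε = δ²`, `w = (b* b + δ²)^(-1/2)` has norm at most `1/δ`, so the error `δ² τ(w)` is at
  -- most `δ`.
  obtain ⟨g, g', hg, hg', h1, h2, h4⟩ := B.exists_fourth_root b (ε := δ ^ 2) (by positivity)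
  set w := g' * g' with hw
  have hws : star w = w := by simp [hw, hg']
  have hbb : star b * b = g * g * (g * g) - ((δ ^ 2 : ℝ) : ℂ) • (1 : B) := by rw [h4]; abel
  have hwu : w * (g * g) = 1 := by
    rw [hw, mul_assoc, ← mul_assoc g' g g, h2, one_mul, h2]
  have huw : g * g * w = 1 := by
    rw [hw, mul_assoc, ← mul_assoc g g' g', h1, one_mul, h1]
  set h : B := w * star b with hh
  have hhh : h * star h = 1 - ((δ ^ 2 : ℝ) : ℂ) • (w * w) := by
    rw [hh, star_mul, star_star, hws, mul_assoc, ← mul_assoc (star b), hbb, sub_mul, mul_sub]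
    rw [mul_assoc (g * g), huw, mul_one, hwu]
    simp
  -- This is `h h* + δ² w² = 1` tested on `v`; it yields both `‖h‖ ≤ 1` and `‖w‖ ≤ 1/δ`.
  have hv : ∀ v : H, ‖(star h : H →L[ℂ] H) v‖ ^ 2 + δ ^ 2 * ‖(w : H →L[ℂ] H) v‖ ^ 2 = ‖v‖ ^ 2 := by
    intro v
    have e1 : ⟪v, ((h * star h : B) : H →L[ℂ] H) v⟫_ℂ =
        ⟪(star h : H →L[ℂ] H) v, (star h : H →L[ℂ] H) v⟫_ℂ := by
      rw [ContinuousLinearMap.star_eq_adjoint, ContinuousLinearMap.adjoint_inner_left]; rfl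
    have e2 : ⟪v, ((w * w : B) : H →L[ℂ] H) v⟫_ℂ =
        ⟪(w : H →L[ℂ] H) v, (w : H →L[ℂ] H) v⟫_ℂ := by
      have : (w : H →L[ℂ] H) = star (w : H →L[ℂ] H) := (congrArg Subtype.val hws).symm
      conv_rhs => rw [this, ContinuousLinearMap.star_eq_adjoint,
        ContinuousLinearMap.adjoint_inner_left, ← ContinuousLinearMap.star_eq_adjoint, ← this]
      rfl
    have e3 : ⟪v, ((h * star h : B) : H →L[ℂ] H) v⟫_ℂ =
        ⟪v, v⟫_ℂ - ((δ ^ 2 : ℝ) : ℂ) * ⟪v, ((w * w : B) : H →L[ℂ] H) v⟫_ℂ := by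
      rw [hhh, ← inner_smul_right, ← inner_sub_right]; rfl
    rw [e1, e2, inner_self_eq_norm_sq_to_K, inner_self_eq_norm_sq_to_K,
      inner_self_eq_norm_sq_to_K] at e3
    simp only [Complex.coe_algebraMap] at e3
    have e4 : ‖(star h : H →L[ℂ] H) v‖ ^ 2 = ‖v‖ ^ 2 - δ ^ 2 * ‖(w : H →L[ℂ] H) v‖ ^ 2 := by
      exact_mod_cast e3
    linarith
  have hh1 : ‖h‖ ≤ 1 := by
    have : ‖(star h : H →L[ℂ] H)‖ ≤ 1 := by
      refine ContinuousLinearMap.opNorm_le_bound _ zero_le_one fun v => ?_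
      rw [one_mul]
      refine le_of_sq_le_sq ?_ (norm_nonneg _)
      have := hv v
      nlinarith [sq_nonneg (δ * ‖(w : H →L[ℂ] H) v‖)]
    rwa [norm_star] at this
  have hw1 : δ ^ 2 * ‖w‖ ≤ δ := by
    have : ‖(w : H →L[ℂ] H)‖ ≤ δ⁻¹ := by
      refine ContinuousLinearMap.opNorm_le_bound _ (by positivity) fun v => ?_
      rw [inv_mul_eq_div, le_div_iff₀ hδ]
      refine le_of_sq_le_sq ?_ (norm_nonneg _)
      have := hv v
      nlinarith [sq_nonneg ‖(star h : H →L[ℂ] H) v‖]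
    calc δ ^ 2 * ‖w‖ ≤ δ ^ 2 * δ⁻¹ := by gcongr; exact this
      _ = δ := by field_simp
  have hreal : ∀ x : B, τ (star x * x) = ((τ (star x * x)).re : ℂ) := fun x =>
    Complex.ext rfl (Complex.nonneg_iff.1 (hτ.nonneg x)).2.symm
  set t := τ (star (b * g') * (b * g')) with ht
  have ht1 : t = τ (star g * g) - ((δ ^ 2 : ℝ) : ℂ) * τ w := by
    rw [ht, star_mul, hg', mul_assoc, hτ.tracial, mul_assoc, ← mul_assoc (star b)]
    rw [mul_assoc, mul_assoc, ← mul_assoc (star b), ← hw, hbb, sub_mul, mul_assoc (g * g), huw]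
    simp [hg]
  have ht2 : τ (h * b) = t := by
    rw [ht1, hh, mul_assoc, hbb, mul_sub, ← mul_assoc, hwu]
    simp [hg]
  refine ⟨h, g, g', t.re, (τ (star g * g)).re, hh1, h2, ?_, hreal _, hreal _, ?_⟩
  · rw [ht2]; exact hreal _
  · have h5 : (τ w).re ≤ ‖w‖ := by
      have := (Complex.le_def.1 (hτ.le_norm hws)).1
      simpa using this
    have h6 := congrArg Complex.re ht1
    simp only [Complex.sub_re, Complex.re_ofReal_mul] at h6
    nlinarith [mul_le_mul_of_nonneg_left h5 (sq_nonneg δ)]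

/-- Any functional dominated by the trace norm `‖b‖₁ = sup {|τ(h b)| : ‖h‖ ≤ 1}` is represented, on
finitely many elements, by an element of the algebra. -/
theorem exists_representing_finite (hτ : IsFaithfulNormalTrace B τ) (ψ : B →ₗ[ℂ] ℂ) {r : ℝ}
    (hr : 0 ≤ r)
    (hψ : ∀ b : B, ∀ δ > 0, ∃ (h : B) (t : ℝ), ‖h‖ ≤ 1 ∧ τ (h * b) = t ∧ ‖ψ b‖ ≤ r * (t + δ))
    (F : Finset B) : ∃ h : B, ‖h‖ ≤ r ∧ ∀ b ∈ F, τ (h * b) = ψ b := by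
  classical
  set Φ : B → (F → ℂ) := fun h b => τ (h * b) with hΦ
  set D : Set (F → ℂ) := Φ '' {h | ‖h‖ ≤ r} with hD
  have hconv : Convex ℝ D := by
    rintro _ ⟨h₁, h₁r, rfl⟩ _ ⟨h₂, h₂r, rfl⟩ p q hp hq hpq
    refine ⟨(p : ℂ) • h₁ + (q : ℂ) • h₂, ?_, ?_⟩
    · calc ‖(p : ℂ) • h₁ + (q : ℂ) • h₂‖ ≤ ‖(p : ℂ) • h₁‖ + ‖(q : ℂ) • h₂‖ := norm_add_le _ _
        _ = p * ‖h₁‖ + q * ‖h₂‖ := by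
          rw [norm_smul, norm_smul, Complex.norm_of_nonneg hp, Complex.norm_of_nonneg hq]
        _ ≤ p * r + q * r := by
          gcongr
          · exact h₁r
          · exact h₂r
        _ = r := by rw [← add_mul, hpq, one_mul]
    · funext b
      simp [hΦ, add_mul]
  have hclosed : IsClosed D := by
    rw [isClosed_iff_ultrafilter]
    intro z F' hF' hDF'
    -- Preimages are chosen for all `z`, with the irrelevant value `0` off `D`, so that the
    -- compactness of the ball applies along `F'`.
    have : ∀ z : F → ℂ, ∃ h : B, z ∈ D → ‖h‖ ≤ r ∧ Φ h = z := by
      intro z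
      by_cases hz : z ∈ D
      · obtain ⟨h, h1, h2⟩ := hz
        exact ⟨h, fun _ => ⟨h1, h2⟩⟩
      · exact ⟨0, fun h => absurd h hz⟩
    choose f hf using this
    obtain ⟨h, hh, hlim⟩ := VonNeumannAlgebra.exists_uwTendsto_of_bounded (f := f) F' (C := r)
      (by filter_upwards [hDF'] with y hy using (hf y hy).1)
    refine ⟨h, hh, ?_⟩
    funext b
    have h1 : Tendsto (fun y : F → ℂ => τ (f y * b)) F' (𝓝 (τ (h * b))) :=
      hτ.tendsto (hlim.mul_right _)
    have h2 : Tendsto (fun y : F → ℂ => y b) F' (𝓝 (z b)) :=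
      ((continuous_apply b).tendsto z).comp hF'
    refine tendsto_nhds_unique (h1.congr' ?_) h2
    filter_upwards [hDF'] with y hy
    exact congrFun (hf y hy).2 b
  by_cases hmem : (fun b : F => ψ b) ∈ D
  · obtain ⟨h, h1, h2⟩ := hmem
    exact ⟨h, h1, fun b hb => congrFun h2 ⟨b, hb⟩⟩
  exfalso
  obtain ⟨f, c, hf1, hf2⟩ :=
    RCLike.geometric_hahn_banach_closed_point (𝕜 := ℂ) hconv hclosed hmem
  -- A functional on `F → ℂ` amounts to a linear combination of `F`: the separation becomes a
  -- violation of the domination at the single element `b₀`.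
  set b₀ : B := ∑ b : F, f (Pi.single b 1) • (b : B) with hb₀
  have hfz : ∀ z : F → ℂ, f z = ∑ b : F, f (Pi.single b 1) * z b := by
    intro z
    conv_lhs => rw [← Finset.univ_sum_single z, map_sum]
    refine Finset.sum_congr rfl fun b _ => ?_
    have : (Pi.single b (z b) : F → ℂ) = z b • Pi.single b 1 := by
      rw [← Pi.single_smul, smul_eq_mul, mul_one]
    rw [this, map_smul, smul_eq_mul, mul_comm]
  have hfψ : f (fun b : F => ψ b) = ψ b₀ := by
    rw [hfz, hb₀, map_sum]; simp
  have hfΦ : ∀ h : B, f (Φ h) = τ (h * b₀) := by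
    intro h
    rw [hfz, hb₀, Finset.mul_sum, map_sum]; simp [hΦ]
  rw [hfψ] at hf2
  set e := RCLike.re (ψ b₀) - c with he
  have he0 : 0 < e := sub_pos.2 hf2
  -- The error must satisfy `r δ ≤ e`, the separation gap; `r + 1` also covers `r = 0`.
  obtain ⟨h, t, hh, ht, hle⟩ := hψ b₀ (e / (r + 1)) (by positivity)
  have h1 := hf1 (Φ ((r : ℂ) • h)) ⟨_, by
    change ‖(r : ℂ) • h‖ ≤ r
    rw [norm_smul, Complex.norm_of_nonneg hr]
    exact mul_le_of_le_one_right hr hh, rfl⟩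
  rw [hfΦ, smul_mul_assoc, map_smul, ht, smul_eq_mul, ← Complex.ofReal_mul] at h1
  simp only [RCLike.re_to_complex, Complex.ofReal_re] at h1 he
  have h2 : (ψ b₀).re ≤ ‖ψ b₀‖ := Complex.re_le_norm _
  have h3 : r * (e / (r + 1)) ≤ e := by
    rw [mul_div_assoc', div_le_iff₀ (by positivity)]
    nlinarith
  linarith [mul_add r t (e / (r + 1))]

/-- An ultraweak limit of the finite solutions, along an ultrafilter finer than the directed order
of finite subsets, works for all `b` at once. -/
theorem exists_representing (hτ : IsFaithfulNormalTrace B τ) (ψ : B →ₗ[ℂ] ℂ) {r : ℝ}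
    (hr : 0 ≤ r)
    (hψ : ∀ b : B, ∀ δ > 0, ∃ (h : B) (t : ℝ), ‖h‖ ≤ 1 ∧ τ (h * b) = t ∧ ‖ψ b‖ ≤ r * (t + δ)) :
    ∃ h : B, ‖h‖ ≤ r ∧ ∀ b, τ (h * b) = ψ b := by
  choose f hf using hτ.exists_representing_finite ψ hr hψ
  obtain ⟨h, hh, hlim⟩ := VonNeumannAlgebra.exists_uwTendsto_of_bounded (f := f)
    (Ultrafilter.of atTop) (C := r) (Eventually.of_forall fun F => (hf F).1)
  refine ⟨h, hh, fun b => ?_⟩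
  refine tendsto_nhds_unique (hτ.tendsto (hlim.mul_right b)) (tendsto_const_nhds.congr' ?_)
  filter_upwards [Ultrafilter.of_le _ (eventually_ge_atTop {b})] with F hF
  exact ((hf F).2 b (hF (Finset.mem_singleton_self b))).symm

variable {K : Type v} [NormedAddCommGroup K] [InnerProductSpace ℂ K] [CompleteSpace K]

/-- Existence of the value at `x` of the trace-preserving conditional expectation. -/
theorem exists_condExp (hτ : IsFaithfulNormalTrace B τ) {A : VonNeumannAlgebra K} {Ω : K}
    (hΩ : ∀ x y : A, ⟪Ω, ((x * y : A) : K →L[ℂ] K) Ω⟫_ℂ = ⟪Ω, ((y * x : A) : K →L[ℂ] K) Ω⟫_ℂ)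
    (incl : B →⋆ₐ[ℂ] A) (hincl : ∀ b, ⟪Ω, (incl b : K →L[ℂ] K) Ω⟫_ℂ = τ b) (x : A) :
    ∃ h : B, ‖h‖ ≤ ‖x‖ ∧ ∀ b, τ (h * b) = ⟪Ω, ((x * incl b : A) : K →L[ℂ] K) Ω⟫_ℂ := by
  have hnorm : ∀ b : B, τ (star b * b) = ((‖(incl b : K →L[ℂ] K) Ω‖ ^ 2 : ℝ) : ℂ) := by
    intro b
    rw [← hincl, map_mul, map_star]
    change ⟪Ω, (star (incl b : K →L[ℂ] K)) ((incl b : K →L[ℂ] K) Ω)⟫_ℂ = _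
    rw [ContinuousLinearMap.star_eq_adjoint, ContinuousLinearMap.adjoint_inner_right,
      inner_self_eq_norm_sq_to_K]
    simp
  let ψ : B →ₗ[ℂ] ℂ :=
    { toFun := fun b => ⟪Ω, ((x * incl b : A) : K →L[ℂ] K) Ω⟫_ℂ
      map_add' := fun b c => by
        rw [map_add, mul_add, ← inner_add_right]; rfl
      map_smul' := fun z b => by
        rw [map_smul, mul_smul_comm, RingHom.id_apply, smul_eq_mul, ← inner_smul_right]; rfl }
  refine hτ.exists_representing ψ (norm_nonneg x) fun b δ hδ => ?_
  obtain ⟨h, g, g', t, s, hh, hgg, h1, h2, h3, hst⟩ := hτ.exists_contraction b hδ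
  refine ⟨h, t, hh, h1, ?_⟩
  -- Write `b = (b g') g` and move `g` to the front by traciality. Cauchy–Schwarz then bounds `|ψ
  -- b|` by `‖x‖ √s √t ≤ ‖x‖ (t + δ)`.
  have e1 : ψ b = ⟪(incl (star g) : K →L[ℂ] K) Ω,
      (x : K →L[ℂ] K) ((incl (b * g') : K →L[ℂ] K) Ω)⟫_ℂ := by
    have h4 : x * incl b = x * incl (b * g') * incl g := by
      rw [mul_assoc, ← map_mul, mul_assoc, hgg, mul_one]
    change ⟪Ω, ((x * incl b : A) : K →L[ℂ] K) Ω⟫_ℂ = _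
    rw [h4, hΩ, map_star]
    change _ = ⟪(star (incl g : K →L[ℂ] K)) Ω, _⟫_ℂ
    rw [ContinuousLinearMap.star_eq_adjoint, ContinuousLinearMap.adjoint_inner_left]
    rfl
  have e2 : ‖(incl (star g) : K →L[ℂ] K) Ω‖ ^ 2 = s := by
    have := hnorm (star g)
    rw [star_star, hτ.tracial, h3] at this
    exact_mod_cast this.symm
  have e3 : ‖(incl (b * g') : K →L[ℂ] K) Ω‖ ^ 2 = t := by
    have := hnorm (b * g')
    rw [h2] at this
    exact_mod_cast this.symm
  have e4 : ‖(incl (star g) : K →L[ℂ] K) Ω‖ * ‖(incl (b * g') : K →L[ℂ] K) Ω‖ ≤ t + δ := by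
    refine le_of_sq_le_sq ?_ (by rw [← e3]; positivity)
    rw [mul_pow, e2, e3]
    have ht0 : 0 ≤ t := by rw [← e3]; positivity
    nlinarith
  calc ‖ψ b‖ ≤ ‖(incl (star g) : K →L[ℂ] K) Ω‖ *
        ‖(x : K →L[ℂ] K) ((incl (b * g') : K →L[ℂ] K) Ω)‖ := by
        rw [e1]; exact norm_inner_le_norm _ _
    _ ≤ ‖(incl (star g) : K →L[ℂ] K) Ω‖ * (‖x‖ * ‖(incl (b * g') : K →L[ℂ] K) Ω‖) := by
        gcongr
        exact ContinuousLinearMap.le_opNorm _ _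
    _ = ‖x‖ * (‖(incl (star g) : K →L[ℂ] K) Ω‖ * ‖(incl (b * g') : K →L[ℂ] K) Ω‖) := by ring
    _ ≤ ‖x‖ * (t + δ) := by gcongr

end IsFaithfulNormalTrace

end conditionalExpectation

/-! ### Positivity of unital contractions and the tracial probability space -/

section conditionalExpectation

open Filter

variable {H : Type u} [NormedAddCommGroup H] [InnerProductSpace ℂ H] [CompleteSpace H]
variable {B : VonNeumannAlgebra H} {τ : B →ₗ[ℂ] ℂ}

/-- As `⟪y v, v⟫` is real, the cross term in `‖y v + i t v‖²` vanishes. Unital contractions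
therefore send self-adjoint elements to self-adjoint ones. -/
theorem ContinuousLinearMap.norm_add_I_smul_sq_le {K : Type*} [NormedAddCommGroup K]
    [InnerProductSpace ℂ K] [CompleteSpace K] {y : K →L[ℂ] K} (hy : IsSelfAdjoint y) (t : ℝ) :
    ‖y + (Complex.I * t) • (1 : K →L[ℂ] K)‖ ^ 2 ≤ ‖y‖ ^ 2 + t ^ 2 := by
  have h : ‖y + (Complex.I * t) • (1 : K →L[ℂ] K)‖ ≤ √(‖y‖ ^ 2 + t ^ 2) := by
    refine ContinuousLinearMap.opNorm_le_bound _ (Real.sqrt_nonneg _) fun v => ?_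
    refine le_of_sq_le_sq ?_ (by positivity)
    rw [mul_pow, Real.sq_sqrt (by positivity)]
    have h1 : ‖(y + (Complex.I * t) • (1 : K →L[ℂ] K)) v‖ ^ 2 = ‖y v‖ ^ 2 + t ^ 2 * ‖v‖ ^ 2 := by
      change ‖y v + (Complex.I * t) • v‖ ^ 2 = _
      rw [@norm_add_sq ℂ, inner_smul_right, norm_smul, mul_pow]
      have h2 : (⟪y v, v⟫_ℂ).im = 0 := by
        apply Complex.conj_eq_iff_im.1
        rw [inner_conj_symm]
        nth_rewrite 2 [← hy.star_eq]
        rw [ContinuousLinearMap.star_eq_adjoint, ContinuousLinearMap.adjoint_inner_left]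
      simp [h2]
    rw [h1, add_mul]
    gcongr
    rw [← mul_pow]
    gcongr
    exact y.le_opNorm v
  calc _ ≤ √(‖y‖ ^ 2 + t ^ 2) ^ 2 := by gcongr
    _ = _ := Real.sq_sqrt (by positivity)

/-- A unital contraction between von Neumann algebras is positive. -/
theorem VonNeumannAlgebra.inner_nonneg_of_contraction {K : Type v} [NormedAddCommGroup K]
    [InnerProductSpace ℂ K] [CompleteSpace K] {A : VonNeumannAlgebra K} (E : A →ₗ[ℂ] B)
    (hE : ∀ x, ‖E x‖ ≤ ‖x‖) (h1 : E 1 = 1) (x : A) (ξ : H) :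
    0 ≤ ⟪ξ, (E (star x * x) : H →L[ℂ] H) ξ⟫_ℂ := by
  set f : A →ₗ[ℂ] ℂ :=
    { toFun := fun y => ⟪ξ, (E y : H →L[ℂ] H) ξ⟫_ℂ
      map_add' := fun y z => by rw [map_add, ← inner_add_right]; rfl
      map_smul' := fun c y => by
        rw [map_smul, RingHom.id_apply, smul_eq_mul, ← inner_smul_right]; rfl } with hf
  have hf1 : f 1 = ((‖ξ‖ ^ 2 : ℝ) : ℂ) := by
    change ⟪ξ, (E 1 : H →L[ℂ] H) ξ⟫_ℂ = _
    rw [h1]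
    change ⟪ξ, ξ⟫_ℂ = _
    rw [inner_self_eq_norm_sq_to_K]
    simp
  set n : ℝ := ‖ξ‖ ^ 2 with hn
  have hn0 : 0 ≤ n := by positivity
  have hfb : ∀ y, ‖f y‖ ≤ ‖y‖ * n := by
    intro y
    calc ‖f y‖ ≤ ‖ξ‖ * ‖(E y : H →L[ℂ] H) ξ‖ := norm_inner_le_norm _ _
      _ ≤ ‖ξ‖ * (‖y‖ * ‖ξ‖) := by
        gcongr
        exact (E y : H →L[ℂ] H).le_of_opNorm_le (hE y) ξ
      _ = _ := by rw [hn]; ring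
  set y : A := star x * x with hy
  have hy0 : (0 : K →L[ℂ] K) ≤ y := star_mul_self_nonneg (x : K →L[ℂ] K)
  change 0 ≤ f y
  rw [Complex.nonneg_iff]
  constructor
  -- From `0 ≤ y ≤ ‖y‖`: contractivity puts `f y` within `‖y‖ n` of `‖y‖ n`, so its real part is
  -- nonnegative.
  · have h2 : ‖(‖y‖ : ℂ) • (1 : A) - y‖ ≤ ‖y‖ := by
      have h3 : (0 : K →L[ℂ] K) ≤ ((‖y‖ : ℂ) • (1 : A) - y : A) := by
        have h4 := sub_nonneg.2 (IsSelfAdjoint.of_nonneg hy0).le_algebraMap_norm_self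
        rw [Algebra.algebraMap_eq_smul_one] at h4
        exact h4
      refine (CStarAlgebra.norm_le_iff_le_algebraMap _ (norm_nonneg y) h3).2 ?_
      rw [Algebra.algebraMap_eq_smul_one]
      exact sub_le_self _ hy0
    have h5 := hfb ((‖y‖ : ℂ) • (1 : A) - y)
    rw [map_sub, map_smul, hf1, smul_eq_mul, ← Complex.ofReal_mul] at h5
    have h6 := (Complex.re_le_norm _).trans (h5.trans (mul_le_mul_of_nonneg_right h2 hn0))
    simp only [Complex.sub_re, Complex.ofReal_re] at h6
    linarith
  · have h2 : ∀ t : ℝ, ((f y).im + t * n) ^ 2 ≤ (‖y‖ ^ 2 + t ^ 2) * n ^ 2 := by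
      intro t
      have h3 := hfb (y + (Complex.I * t) • (1 : A))
      have h4 : ‖y + (Complex.I * t) • (1 : A)‖ ^ 2 ≤ ‖y‖ ^ 2 + t ^ 2 :=
        ContinuousLinearMap.norm_add_I_smul_sq_le (IsSelfAdjoint.of_nonneg hy0) t
      rw [map_add, map_smul, hf1] at h3
      have h5 := (Complex.abs_im_le_norm _).trans h3
      have h6 : (f y + (Complex.I * t) • (n : ℂ)).im = (f y).im + t * n := by simp
      rw [h6] at h5
      calc ((f y).im + t * n) ^ 2 ≤ (‖y + (Complex.I * t) • (1 : A)‖ * n) ^ 2 :=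
            sq_le_sq' (abs_le.1 h5).1 (abs_le.1 h5).2
        _ ≤ _ := by rw [mul_pow]; gcongr
    by_contra hne
    have hne' : (f y).im ≠ 0 := fun h => hne h.symm
    have hnpos : 0 < n := by
      rcases hn0.lt_or_eq with h | h
      · exact h
      · exfalso
        have := (Complex.abs_im_le_norm _).trans (hfb y)
        rw [← h, mul_zero] at this
        exact hne' (abs_nonpos_iff.1 this)
    -- The terms `t² n²` cancel in `h2`; this `t` makes the cross term `2 ‖y‖² n²`, which exceeds
    -- the remaining right side `‖y‖² n²`.
    have h3 := h2 (‖y‖ ^ 2 * n / (f y).im)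
    have h4 : ‖y‖ ^ 2 * n / (f y).im * (f y).im = ‖y‖ ^ 2 * n := div_mul_cancel₀ _ hne'
    set t := ‖y‖ ^ 2 * n / (f y).im
    have h5 : 0 < (f y).im ^ 2 := by positivity
    have h6 : 0 ≤ ‖y‖ ^ 2 * n ^ 2 := by positivity
    nlinarith

variable {K : Type u} [NormedAddCommGroup K] [InnerProductSpace ℂ K] [CompleteSpace K]

/-- A tracial von Neumann algebra that contains `B`, with trace the vector state of `Ω`, is a
tracial W*-probability space over `B`, and the conditional expectation of `x` is characterized by
its traces against `B`. -/
theorem IsFaithfulNormalTrace.exists_tracialProbSpace (hτ : IsFaithfulNormalTrace B τ)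
    {A : VonNeumannAlgebra K} {τA : A →ₗ[ℂ] ℂ} (hA : IsFaithfulNormalTrace A τA) {Ω : K}
    (hΩ : ∀ x, τA x = ⟪Ω, (x : K →L[ℂ] K) Ω⟫_ℂ) (incl : B →⋆ₐ[ℂ] A)
    (hincl : ∀ b, τA (incl b) = τ b)
    (hnormal : ∀ (l : Filter B) (b : B), (∀ᶠ c in l, ‖c‖ ≤ 1) → B.UWTendsto id l b →
      A.UWTendsto incl l (incl b)) :
    ∃ (E : A →ₗ[ℂ] B), (∀ x b, τ (E x * b) = τA (x * incl b)) ∧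
      ∃ S : TracialProbSpace B τ, ∃ a : A → S.A, (∀ x, IsSelfAdjoint x → IsSelfAdjoint (a x)) ∧
      ∀ x P, S.E (NCPoly.eval S.incl.toAlgHom (a x) P) = E (NCPoly.eval incl.toAlgHom x P) := by
  have hex : ∀ x : A, ∃ h : B, ‖h‖ ≤ ‖x‖ ∧ ∀ b, τ (h * b) = τA (x * incl b) := by
    intro x
    simp only [hΩ]
    refine hτ.exists_condExp (fun x y => ?_) incl (fun b => ?_) x
    · rw [← hΩ, ← hΩ, hA.tracial]
    · rw [← hΩ, hincl]
  choose E₀ hE₀ hE₁ using hex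
  let E : A →ₗ[ℂ] B :=
    { toFun := E₀
      map_add' := fun x y => hτ.eq_of_forall_mul fun b => by
        rw [add_mul, map_add, hE₁, hE₁, hE₁, add_mul, map_add]
      map_smul' := fun c x => hτ.eq_of_forall_mul fun b => by
        rw [RingHom.id_apply, smul_mul_assoc, map_smul, hE₁, hE₁, smul_mul_assoc, map_smul] }
  have hE : ∀ x b, τ (E x * b) = τA (x * incl b) := hE₁
  have hEincl : ∀ b, E (incl b) = b := fun b => hτ.eq_of_forall_mul fun c => by
    rw [hE, ← map_mul, hincl]
  refine ⟨E, hE,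
    { K := K, A := A, τA := τA, isTrace := hA, incl := incl
      incl_injective := ?_, incl_normal := ?_, trace_incl := hincl, E := E, E_incl := hEincl
      E_bimodular := ?_, E_positive := ?_, trace_E := ?_ }, id, fun x hx => hx, fun x P => rfl⟩
  · exact Function.LeftInverse.injective hEincl
  · intro b _
    exact hnormal _ b (@self_mem_nhdsWithin B B.ultraweak b _)
      (@nhdsWithin_le_nhds B B.ultraweak b _)
  · intro b c x
    refine hτ.eq_of_forall_mul fun d => ?_
    rw [hE, mul_assoc, mul_assoc, hA.tracial, mul_assoc, mul_assoc, ← map_mul, ← map_mul, ← hE,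
      mul_assoc, mul_assoc, hτ.tracial b, mul_assoc, mul_assoc]
  · refine VonNeumannAlgebra.inner_nonneg_of_contraction E hE₀ ?_
    rw [← _root_.map_one incl, hEincl]
  · intro x
    have := hE x 1
    rwa [_root_.map_one, mul_one, mul_one] at this

end conditionalExpectation

/-! ### The GNS von Neumann algebra of a bounded tracial state -/

section gns

open UniformSpace Completion Filter

/-- A tracial state on a *-algebra, whose left multiplication operators are bounded. -/
structure BoundedTracialState (P : Type u) [Ring P] [StarRing P] [Algebra ℂ P] where
  /-- The state. -/
  φ : P →ₗ[ℂ] ℂ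
  map_one : φ 1 = 1
  nonneg : ∀ p, 0 ≤ φ (star p * p)
  tracial : ∀ p q, φ (p * q) = φ (q * p)
  bounded : ∀ p, ∃ C : ℝ, ∀ q, (φ (star (p * q) * (p * q))).re ≤ C * (φ (star q * q)).re

/-- A positive functional on a *-algebra is hermitian. -/
theorem conj_map_star_mul_of_nonneg {P : Type*} [Ring P] [StarRing P] [Algebra ℂ P]
    [StarModule ℂ P] {φ : P →ₗ[ℂ] ℂ} (h : ∀ p, 0 ≤ φ (star p * p)) (p q : P) :
    starRingEnd ℂ (φ (star q * p)) = φ (star p * q) := by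
  have him : ∀ p, (φ (star p * p)).im = 0 := fun p => (Complex.nonneg_iff.1 (h p)).2.symm
  have h1 := him (p + q)
  have h2 := him (p + Complex.I • q)
  simp only [star_add, star_smul, add_mul, mul_add, map_add, smul_mul_assoc, mul_smul_comm,
    map_smul, Complex.add_im, him, smul_eq_mul, Complex.star_def, Complex.conj_I,
    Complex.mul_im, Complex.mul_re, Complex.neg_re, Complex.neg_im, Complex.I_re,
    Complex.I_im] at h1 h2
  apply Complex.ext
  · simp only [Complex.conj_re]; linarith
  · simp only [Complex.conj_im]; linarith

/-- The semi-inner product `⟨p, q⟩ = φ(p* q)` of a positive functional on a *-algebra. -/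
noncomputable abbrev starMulCore {P : Type*} [Ring P] [StarRing P] [Algebra ℂ P]
    [StarModule ℂ P] (φ : P →ₗ[ℂ] ℂ) (h : ∀ p, 0 ≤ φ (star p * p)) :
    PreInnerProductSpace.Core ℂ P where
  inner p q := φ (star p * q)
  conj_inner_symm p q := conj_map_star_mul_of_nonneg h _ _
  re_inner_nonneg p := (Complex.nonneg_iff.1 (h _)).1
  add_left _ _ _ := by rw [star_add, add_mul, map_add]
  smul_left _ _ _ := by simp

theorem norm_map_star_mul_sq_le {P : Type*} [Ring P] [StarRing P] [Algebra ℂ P]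
    [StarModule ℂ P] {φ : P →ₗ[ℂ] ℂ} (h : ∀ p, 0 ≤ φ (star p * p)) (p q : P) :
    ‖φ (star p * q)‖ ^ 2 ≤ (φ (star p * p)).re * (φ (star q * q)).re := by
  have h1 := @InnerProductSpace.Core.inner_mul_inner_self_le ℂ P _ _ _ (starMulCore φ h) p q
  have h2 : ‖φ (star q * p)‖ = ‖φ (star p * q)‖ := by
    rw [← conj_map_star_mul_of_nonneg h p q, RCLike.norm_conj]
  change ‖φ (star p * q)‖ * ‖φ (star q * p)‖ ≤ _ at h1
  rw [h2, ← sq] at h1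
  exact h1

namespace BoundedTracialState

variable {P : Type u} [Ring P] [StarRing P] [Algebra ℂ P] [StarModule ℂ P]
variable (s : BoundedTracialState P)

set_option linter.unusedVariables false in
/-- The *-algebra with the semi-inner product of a state. -/
@[nolint unusedArguments]
def PreGNS (s : BoundedTracialState P) := P

instance : AddCommGroup s.PreGNS := inferInstanceAs (AddCommGroup P)
instance : Module ℂ s.PreGNS := inferInstanceAs (Module ℂ P)

/-- The identity from the algebra to the pre-Hilbert space. -/
def toPreGNS : P ≃ₗ[ℂ] s.PreGNS := LinearEquiv.refl ℂ _

/-- The semi-inner product `⟨p, q⟩ = φ(p* q)`. -/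
noncomputable abbrev core : PreInnerProductSpace.Core ℂ s.PreGNS :=
  starMulCore (P := P) s.φ s.nonneg

noncomputable instance : SeminormedAddCommGroup s.PreGNS :=
  InnerProductSpace.Core.toSeminormedAddCommGroup (c := s.core)

noncomputable instance : InnerProductSpace ℂ s.PreGNS :=
  InnerProductSpace.ofCore s.core

theorem inner_toPreGNS (p q : P) : ⟪s.toPreGNS p, s.toPreGNS q⟫_ℂ = s.φ (star p * q) := rfl

theorem norm_sq_toPreGNS (p : P) : ‖s.toPreGNS p‖ ^ 2 = (s.φ (star p * p)).re := by
  rw [← inner_toPreGNS, inner_self_eq_norm_sq_to_K]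
  norm_cast

/-- The Hilbert space of the state. -/
abbrev GNS := Completion s.PreGNS

/-- The vector of an element of the algebra. -/
noncomputable def vec (p : P) : s.GNS := (s.toPreGNS p : s.PreGNS)

theorem inner_vec (p q : P) : ⟪s.vec p, s.vec q⟫_ℂ = s.φ (star p * q) := by
  rw [vec, vec, Completion.inner_coe, inner_toPreGNS]

theorem norm_sq_vec (p : P) : ‖s.vec p‖ ^ 2 = (s.φ (star p * p)).re := by
  rw [vec, Completion.norm_coe, norm_sq_toPreGNS]

theorem denseRange_vec : DenseRange s.vec :=
  denseRange_coe.comp s.toPreGNS.surjective.denseRange (continuous_coe _)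

/-- Traciality makes the involution isometric; it exchanges left and right multiplications, so the
latter are bounded too. -/
theorem norm_vec_star (p : P) : ‖s.vec (star p)‖ = ‖s.vec p‖ := by
  have : ‖s.vec (star p)‖ ^ 2 = ‖s.vec p‖ ^ 2 := by
    rw [norm_sq_vec, norm_sq_vec, star_star, s.tracial]
  exact (sq_eq_sq₀ (norm_nonneg _) (norm_nonneg _)).1 this

theorem exists_norm_vec_mul_le (p : P) : ∃ C : ℝ, ∀ q, ‖s.vec (p * q)‖ ≤ C * ‖s.vec q‖ := by
  obtain ⟨C, hC⟩ := s.bounded p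
  refine ⟨√|C|, fun q => le_of_sq_le_sq ?_ (by positivity)⟩
  rw [mul_pow, Real.sq_sqrt (abs_nonneg _), norm_sq_vec]
  refine (hC q).trans ?_
  rw [← norm_sq_vec]
  gcongr
  exact le_abs_self C

theorem exists_norm_vec_mul_le' (p : P) : ∃ C : ℝ, ∀ q, ‖s.vec (q * p)‖ ≤ C * ‖s.vec q‖ := by
  obtain ⟨C, hC⟩ := s.exists_norm_vec_mul_le (star p)
  refine ⟨C, fun q => ?_⟩
  rw [← norm_vec_star, star_mul, ← s.norm_vec_star q]
  exact hC _

/-- A linear map of the algebra that is bounded for the norm of the state extends to the Hilbert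
space. -/
theorem exists_extension (f : P →ₗ[ℂ] P) (hf : ∃ C : ℝ, ∀ q, ‖s.vec (f q)‖ ≤ C * ‖s.vec q‖) :
    ∃ T : s.GNS →L[ℂ] s.GNS, ∀ q, T (s.vec q) = s.vec (f q) := by
  obtain ⟨C, hC⟩ := hf
  refine ⟨((s.toPreGNS.toLinearMap ∘ₗ f ∘ₗ s.toPreGNS.symm.toLinearMap).mkContinuous C
    fun q => ?_).completion, fun q => ?_⟩
  · have := hC (s.toPreGNS.symm q)
    rw [vec, vec, Completion.norm_coe, Completion.norm_coe] at this
    exact this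
  · rw [vec, ContinuousLinearMap.completion_apply_coe]; rfl

/-- Left multiplication on the Hilbert space of the state. -/
noncomputable def left (p : P) : s.GNS →L[ℂ] s.GNS :=
  (s.exists_extension (LinearMap.mulLeft ℂ p) (s.exists_norm_vec_mul_le p)).choose

/-- Right multiplication on the Hilbert space of the state. -/
noncomputable def right (p : P) : s.GNS →L[ℂ] s.GNS :=
  (s.exists_extension (LinearMap.mulRight ℂ p) (s.exists_norm_vec_mul_le' p)).choose

@[simp]
theorem left_vec (p q : P) : s.left p (s.vec q) = s.vec (p * q) :=
  (s.exists_extension (LinearMap.mulLeft ℂ p) (s.exists_norm_vec_mul_le p)).choose_spec q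

@[simp]
theorem right_vec (p q : P) : s.right p (s.vec q) = s.vec (q * p) :=
  (s.exists_extension (LinearMap.mulRight ℂ p) (s.exists_norm_vec_mul_le' p)).choose_spec q

theorem clm_ext {S T : s.GNS →L[ℂ] s.GNS} (h : ∀ p, S (s.vec p) = T (s.vec p)) : S = T :=
  ContinuousLinearMap.ext fun x => congrFun
    (s.denseRange_vec.equalizer S.continuous T.continuous (funext h)) x

theorem vec_ext {x y : s.GNS} (h : ∀ p, ⟪s.vec p, x⟫_ℂ = ⟪s.vec p, y⟫_ℂ) : x = y :=
  ext_inner_left ℂ fun z => congrFun (s.denseRange_vec.equalizer (g := fun z => ⟪z, x⟫_ℂ)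
    (h := fun z => ⟪z, y⟫_ℂ) (by fun_prop) (by fun_prop) (funext h)) z

theorem vec_add (p q : P) : s.vec (p + q) = s.vec p + s.vec q := by
  rw [vec, map_add, Completion.coe_add]; rfl

theorem vec_smul (c : ℂ) (p : P) : s.vec (c • p) = c • s.vec p := by
  rw [vec, map_smul, Completion.coe_smul]; rfl

theorem star_left (p : P) : star (s.left p) = s.left (star p) := by
  refine s.clm_ext fun q => s.vec_ext fun r => ?_
  rw [ContinuousLinearMap.star_eq_adjoint, ContinuousLinearMap.adjoint_inner_right, left_vec,
    left_vec, inner_vec, inner_vec, star_mul, mul_assoc]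

theorem star_right (p : P) : star (s.right p) = s.right (star p) := by
  refine s.clm_ext fun q => s.vec_ext fun r => ?_
  rw [ContinuousLinearMap.star_eq_adjoint, ContinuousLinearMap.adjoint_inner_right, right_vec,
    right_vec, inner_vec, inner_vec, star_mul, mul_assoc, s.tracial, mul_assoc]

/-- The von Neumann algebra of a bounded tracial state, as the commutant of the right
multiplications. -/
noncomputable def vonNeumann : VonNeumannAlgebra s.GNS where
  toStarSubalgebra := StarSubalgebra.centralizer ℂ (Set.range s.right)
  centralizer_centralizer' := by simp

theorem mem_vonNeumann {x : s.GNS →L[ℂ] s.GNS} :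
    x ∈ s.vonNeumann ↔ ∀ p, s.right p * x = x * s.right p := by
  change x ∈ StarSubalgebra.centralizer ℂ (Set.range s.right) ↔ _
  rw [StarSubalgebra.mem_centralizer_iff]
  simp only [Set.forall_mem_range, star_right]
  exact ⟨fun h p => (h p).1, fun h p => ⟨h p, h _⟩⟩

theorem right_apply (x : s.vonNeumann) (p : P) (v : s.GNS) :
    s.right p ((x : s.GNS →L[ℂ] s.GNS) v) = (x : s.GNS →L[ℂ] s.GNS) (s.right p v) :=
  congrArg (fun T : s.GNS →L[ℂ] s.GNS => T v) (s.mem_vonNeumann.1 x.2 p)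

/-- The vector of `1` is separating: its image determines `x`, which gives faithfulness of the
trace. -/
theorem apply_vec (x : s.vonNeumann) (p : P) :
    (x : s.GNS →L[ℂ] s.GNS) (s.vec p) = s.right p ((x : s.GNS →L[ℂ] s.GNS) (s.vec 1)) := by
  rw [right_apply, right_vec, one_mul]

/-- The representation by left multiplications. -/
noncomputable def rep : P →⋆ₐ[ℂ] s.vonNeumann where
  toFun p := ⟨s.left p, s.mem_vonNeumann.2 fun q => s.clm_ext fun r => by
    simp [mul_assoc]⟩
  map_one' := Subtype.ext (s.clm_ext fun r => by simp)
  map_mul' p q := Subtype.ext (s.clm_ext fun r => by simp [mul_assoc])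
  map_zero' := Subtype.ext (s.clm_ext fun r => by
    have : s.vec 0 = 0 := by simpa using s.vec_smul 0 0
    simp [this])
  map_add' p q := Subtype.ext (s.clm_ext fun r => by simp [add_mul, vec_add])
  commutes' c := Subtype.ext (s.clm_ext fun r => by
    rw [left_vec, ← Algebra.smul_def, vec_smul, Algebra.algebraMap_eq_smul_one]; rfl)
  map_star' p := Subtype.ext (s.star_left p).symm

theorem rep_vec (p q : P) : (s.rep p : s.GNS →L[ℂ] s.GNS) (s.vec q) = s.vec (p * q) :=
  s.left_vec p q

theorem denseRange_rep : DenseRange fun p => (s.rep p : s.GNS →L[ℂ] s.GNS) (s.vec 1) := by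
  simpa only [rep_vec, mul_one] using s.denseRange_vec

theorem inner_star_apply_vec_one (x : s.vonNeumann) (p : P) :
    ⟪((star x : s.vonNeumann) : s.GNS →L[ℂ] s.GNS) (s.vec 1), s.vec p⟫_ℂ =
      ⟪s.vec (star p), (x : s.GNS →L[ℂ] s.GNS) (s.vec 1)⟫_ℂ := by
  change ⟪(star (x : s.GNS →L[ℂ] s.GNS)) (s.vec 1), s.vec p⟫_ℂ = _
  rw [ContinuousLinearMap.star_eq_adjoint, ContinuousLinearMap.adjoint_inner_left, apply_vec,
    ← ContinuousLinearMap.adjoint_inner_left, ← ContinuousLinearMap.star_eq_adjoint, star_right,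
    right_vec, one_mul]

/-- The commutant is not assumed to be generated by the left multiplications, so traciality is not
inherited by density. Instead `x* Ω` is paired with the dense vectors, where commutation with right
multiplications turns `x*` into `x`. Applied to `x` and `x*`, this gives `τ(x* x) = τ(x x*)`. -/
theorem norm_star_apply_vec_one_le (x : s.vonNeumann) :
    ‖((star x : s.vonNeumann) : s.GNS →L[ℂ] s.GNS) (s.vec 1)‖ ≤
      ‖(x : s.GNS →L[ℂ] s.GNS) (s.vec 1)‖ := by
  set y := ((star x : s.vonNeumann) : s.GNS →L[ℂ] s.GNS) (s.vec 1) with hy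
  set z := (x : s.GNS →L[ℂ] s.GNS) (s.vec 1) with hz
  have h : ∀ v : s.GNS, ‖⟪y, v⟫_ℂ‖ ≤ ‖v‖ * ‖z‖ := by
    intro v
    induction v using s.denseRange_vec.induction_on with
    | hp => exact isClosed_le (by fun_prop) (by fun_prop)
    | ih p =>
      rw [hy, inner_star_apply_vec_one, ← s.norm_vec_star p]
      exact norm_inner_le_norm _ _
  have h1 := h y
  rw [inner_self_eq_norm_sq_to_K, norm_pow, RCLike.norm_ofReal, abs_norm, sq] at h1
  rcases (norm_nonneg y).eq_or_lt with h0 | h0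
  · rw [← h0]; positivity
  · exact le_of_mul_le_mul_left h1 h0

/-- The vector state of the unit. -/
noncomputable def trace : s.vonNeumann →ₗ[ℂ] ℂ where
  toFun x := ⟪s.vec 1, (x : s.GNS →L[ℂ] s.GNS) (s.vec 1)⟫_ℂ
  map_add' x y := by rw [← inner_add_right]; rfl
  map_smul' c x := by rw [RingHom.id_apply, smul_eq_mul, ← inner_smul_right]; rfl

theorem trace_apply (x : s.vonNeumann) :
    s.trace x = ⟪s.vec 1, (x : s.GNS →L[ℂ] s.GNS) (s.vec 1)⟫_ℂ := rfl

theorem trace_rep (p : P) : s.trace (s.rep p) = s.φ p := by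
  rw [trace_apply, rep_vec, inner_vec, star_one, one_mul, mul_one]

theorem trace_star_mul_self (x : s.vonNeumann) :
    s.trace (star x * x) = ((‖(x : s.GNS →L[ℂ] s.GNS) (s.vec 1)‖ ^ 2 : ℝ) : ℂ) := by
  rw [trace_apply]
  change ⟪s.vec 1, (star (x : s.GNS →L[ℂ] s.GNS)) ((x : s.GNS →L[ℂ] s.GNS) (s.vec 1))⟫_ℂ = _
  rw [ContinuousLinearMap.star_eq_adjoint, ContinuousLinearMap.adjoint_inner_right,
    inner_self_eq_norm_sq_to_K]
  simp

theorem trace_star_mul_comm (x : s.vonNeumann) : s.trace (star x * x) = s.trace (x * star x) := by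
  have h1 := s.norm_star_apply_vec_one_le x
  have h2 := s.norm_star_apply_vec_one_le (star x)
  rw [star_star] at h2
  have h3 := s.trace_star_mul_self (star x)
  rw [star_star] at h3
  rw [trace_star_mul_self, h3, le_antisymm h1 h2]

theorem isFaithfulNormalTrace : IsFaithfulNormalTrace s.vonNeumann s.trace where
  map_one := by rw [← _root_.map_one s.rep, trace_rep, s.map_one]
  nonneg x := by
    rw [trace_star_mul_self]
    exact Complex.zero_le_real.2 (sq_nonneg _)
  faithful x hx := by
    rw [trace_star_mul_self] at hx
    have hx0 : (x : s.GNS →L[ℂ] s.GNS) (s.vec 1) = 0 := by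
      have : ‖(x : s.GNS →L[ℂ] s.GNS) (s.vec 1)‖ ^ 2 = 0 := by exact_mod_cast hx
      simpa using this
    exact Subtype.ext (s.clm_ext fun p => by rw [apply_vec, hx0, map_zero]; rfl)
  -- Polarization of `τ(x* x) = τ(x x*)`: the pairs `(x*, y)` and `(x*, i y)` together isolate `τ(x
  -- y) = τ(y x)`.
  tracial := by
    have h1 : ∀ x y : s.vonNeumann, s.trace (star x * y) + s.trace (star y * x) =
        s.trace (y * star x) + s.trace (x * star y) := by
      intro x y
      have h := s.trace_star_mul_comm (x + y)
      have hx := s.trace_star_mul_comm x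
      have hy := s.trace_star_mul_comm y
      simp only [star_add, add_mul, mul_add, map_add] at h
      linear_combination h - hx - hy
    intro x y
    have h2 := h1 (star x) y
    have h3 := h1 (star x) (Complex.I • y)
    simp only [star_star, star_smul, smul_mul_assoc, mul_smul_comm, map_smul, smul_eq_mul,
      Complex.star_def, Complex.conj_I] at h2 h3
    linear_combination h2 / 2 - Complex.I / 2 * h3 + (1 / 2) * (s.trace (x * y) -
      s.trace (star y * star x) - s.trace (y * x) + s.trace (star x * star y)) * Complex.I_sq
  normal := by
    refine @continuous_iff_continuousAt _ _ s.vonNeumann.ultraweak _ _ |>.2 fun x => ?_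
    have h : s.vonNeumann.UWTendsto id (@nhds _ s.vonNeumann.ultraweak x) x := tendsto_id
    exact h.inner (s.vec 1) (s.vec 1)

end BoundedTracialState

end gns

/-! ### Monomials as a spanning set, and log-convex sequences -/

namespace NCPoly

section span

variable {R : Type u} [Ring R] [Algebra ℂ R]

theorem algebraMap_eq_C (z : ℂ) : algebraMap ℂ (NCPoly R) z = C (algebraMap ℂ R z) :=
  ((C : R →ₐ[ℂ] NCPoly R).commutes z).symm

instance [StarRing R] [StarModule ℂ R] : StarModule ℂ (NCPoly R) where
  star_smul z P := by
    rw [Algebra.smul_def, star_mul, algebraMap_eq_C, star_C, ← algebraMap_star_comm,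
      ← algebraMap_eq_C, ← Algebra.commutes, ← Algebra.smul_def]

/-- The constants and the monomials `b X b₁ X ⋯ X bₙ X c`. -/
inductive IsMonomial : NCPoly R → Prop
  | const (b : R) : IsMonomial (C b)
  | mono (b : R) (l : List R) (c : R) : IsMonomial (C b * monomial l * C c)

theorem mul_mem_span_isMonomial (P : NCPoly R) :
    ∀ Q ∈ Submodule.span ℂ {Q : NCPoly R | IsMonomial Q},
      P * Q ∈ Submodule.span ℂ {Q : NCPoly R | IsMonomial Q} := by
  have key : ∀ P : NCPoly R, (∀ Q, IsMonomial Q → IsMonomial (P * Q)) →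
      ∀ Q ∈ Submodule.span ℂ {Q : NCPoly R | IsMonomial Q},
        P * Q ∈ Submodule.span ℂ {Q : NCPoly R | IsMonomial Q} := by
    intro P hP Q hQ
    induction hQ using Submodule.span_induction with
    | mem Q hQ => exact Submodule.subset_span (hP Q hQ)
    | zero => rw [mul_zero]; exact zero_mem _
    | add Q Q' _ _ h h' => rw [mul_add]; exact add_mem h h'
    | smul z Q _ h => rw [mul_smul_comm]; exact Submodule.smul_mem _ _ h
  induction P using NCPoly.induction with
  | hC a =>
    refine key _ ?_
    rintro _ (b | ⟨b, l, c⟩)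
    · rw [← map_mul]; exact .const _
    · rw [← mul_assoc, ← mul_assoc, ← map_mul]; exact .mono _ _ _
  | hX =>
    refine key _ ?_
    rintro _ (b | ⟨b, l, c⟩)
    · have := IsMonomial.mono 1 [] b
      rwa [map_one, one_mul] at this
    · have := IsMonomial.mono 1 (b :: l) c
      rwa [map_one, one_mul, monomial, mul_assoc, mul_assoc, ← mul_assoc (C b)] at this
  | hadd P P' h h' => intro Q hQ; rw [add_mul]; exact add_mem (h Q hQ) (h' Q hQ)
  | hmul P P' h h' => intro Q hQ; rw [mul_assoc]; exact h _ (h' Q hQ)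

theorem span_isMonomial (P : NCPoly R) : P ∈ Submodule.span ℂ {Q : NCPoly R | IsMonomial Q} := by
  have := mul_mem_span_isMonomial P 1 (Submodule.subset_span (by
    have := IsMonomial.const (1 : R)
    rwa [map_one] at this))
  rwa [mul_one] at this

theorem monomial_mul_C_mul_monomial (l l' : List R) (c : R) :
    monomial l * C c * monomial l' = monomial (l ++ c :: l') := by
  induction l with
  | nil => rfl
  | cons b l ih => simp only [List.cons_append, monomial, mul_assoc] at ih ⊢; rw [ih]

theorem monomial_replicate_one (k : ℕ) :
    monomial (List.replicate k (1 : R)) = X ^ (k + 1) := by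
  induction k with
  | zero => simp [monomial]
  | succ k ih => rw [List.replicate_succ, monomial, ih, map_one, mul_one, ← pow_succ']

end span

end NCPoly

/-- Successive ratios of a log-convex sequence do not decrease, so a first ratio `q > r` forces
growth `q ^ k`, against the bound `K r ^ k`. This removes the constant `K`, which in the application
depends on the vector. -/
theorem le_mul_of_logConvex {a : ℕ → ℝ} {K r : ℝ} (h0 : ∀ k, 0 ≤ a k)
    (hconv : ∀ k, a (k + 1) ^ 2 ≤ a k * a (k + 2)) (hr : 0 ≤ r) (hbd : ∀ k, a k ≤ K * r ^ k) :
    a 1 ≤ r * a 0 := by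
  by_contra! hlt
  have ha0 : 0 < a 0 := by
    rcases (h0 0).eq_or_lt with h | h
    · have := hconv 0
      rw [← h, zero_mul] at this
      have h1 : a 1 = 0 := by simpa using le_antisymm this (sq_nonneg _)
      rw [h1, ← h, mul_zero] at hlt
      exact absurd hlt (lt_irrefl _)
    · exact h
  set q := a 1 / a 0 with hq
  have hrq : r < q := by rwa [hq, lt_div_iff₀ ha0]
  have hq0 : 0 < q := hr.trans_lt hrq
  have hstep : ∀ k, 0 < a k ∧ q * a k ≤ a (k + 1) := by
    intro k
    induction k with
    | zero => exact ⟨ha0, by rw [hq, div_mul_cancel₀ _ ha0.ne']⟩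
    | succ k ih =>
      have hpos : 0 < a (k + 1) := (mul_pos hq0 ih.1).trans_le ih.2
      refine ⟨hpos, ?_⟩
      have h1 : a k * (q * a (k + 1)) ≤ a k * a (k + 2) := by
        refine le_trans ?_ (hconv k)
        nlinarith [mul_le_mul_of_nonneg_right ih.2 hpos.le]
      exact le_of_mul_le_mul_left h1 ih.1
  have hpow : ∀ k, q ^ k * a 0 ≤ a k := by
    intro k
    induction k with
    | zero => simp
    | succ k ih =>
      refine le_trans ?_ (hstep k).2
      rw [pow_succ', mul_assoc]
      gcongr
  have hK : 0 < K := by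
    have := hbd 0
    rw [pow_zero, mul_one] at this
    linarith
  -- For `r = 0` the ratio `q / r` is useless, but the bound at `k = 1` already fails.
  rcases hr.eq_or_lt with h | h
  · have h1 := (hpow 1).trans (hbd 1)
    rw [← h, pow_one, pow_one, mul_zero] at h1
    nlinarith [mul_pos hq0 ha0]
  · obtain ⟨k, hk⟩ := pow_unbounded_of_one_lt (K / a 0) ((one_lt_div h).2 hrq)
    rw [div_pow, div_lt_div_iff₀ ha0 (by positivity)] at hk
    exact absurd ((hpow k).trans (hbd k)) (not_le.2 hk)

/-! ### Uniform bounds, and boundedness of the state `τ ∘ μ` -/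

section distributions

open Filter

variable {H : Type u} [NormedAddCommGroup H] [InnerProductSpace ℂ H] [CompleteSpace H]
variable {B : VonNeumannAlgebra H} {τ : B →ₗ[ℂ] ℂ}

/-- An algebraic certificate of `b* b ≤ ‖b‖²`, which *-homomorphisms and positive functionals on
polynomials can transport. -/
theorem VonNeumannAlgebra.exists_norm_sq_sub (b : B) :
    ∃ c : B, star c * c = ((‖b‖ ^ 2 : ℝ) : ℂ) • (1 : B) - star b * b := by
  have h : (0 : H →L[ℂ] H) ≤ (((‖b‖ ^ 2 : ℝ) : ℂ) • (1 : B) - star b * b : B) := by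
    have h1 := sub_nonneg.2
      (CStarAlgebra.star_mul_le_algebraMap_norm_sq (a := (b : H →L[ℂ] H)))
    rw [Algebra.algebraMap_eq_smul_one] at h1
    exact h1
  obtain ⟨c, hc, hcc⟩ := exists_sqrt h
  exact ⟨c, by rw [hc, hcc]⟩

theorem VonNeumannAlgebra.norm_starAlgHom_le {K : Type v} [NormedAddCommGroup K]
    [InnerProductSpace ℂ K] [CompleteSpace K] {A : VonNeumannAlgebra K} (f : B →⋆ₐ[ℂ] A) (b : B) :
    ‖f b‖ ≤ ‖b‖ := by
  obtain ⟨c, hc⟩ := exists_norm_sq_sub b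
  have hf := congrArg f hc
  rw [map_sub, map_smul, map_one, map_mul, map_mul, map_star, map_star] at hf
  have key : ∀ (x : A) (v : K), ⟪v, ((star x * x : A) : K →L[ℂ] K) v⟫_ℂ =
      ((‖(x : K →L[ℂ] K) v‖ ^ 2 : ℝ) : ℂ) := by
    intro x v
    change ⟪v, (star (x : K →L[ℂ] K)) ((x : K →L[ℂ] K) v)⟫_ℂ = _
    rw [ContinuousLinearMap.star_eq_adjoint, ContinuousLinearMap.adjoint_inner_right,
      inner_self_eq_norm_sq_to_K]
    simp
  refine ContinuousLinearMap.opNorm_le_bound _ (norm_nonneg _) fun v => ?_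
  refine le_of_sq_le_sq ?_ (by positivity)
  have h1 := congrArg (fun x : A => ⟪v, (x : K →L[ℂ] K) v⟫_ℂ) hf
  have h2 : ⟪v, ((((‖b‖ ^ 2 : ℝ) : ℂ) • (1 : A) - star (f b) * f b : A) : K →L[ℂ] K) v⟫_ℂ =
      ((‖b‖ ^ 2 : ℝ) : ℂ) * ⟪v, v⟫_ℂ - ⟪v, ((star (f b) * f b : A) : K →L[ℂ] K) v⟫_ℂ := by
    rw [← inner_smul_right, ← inner_sub_right]; rfl
  simp only [h2, key] at h1
  rw [inner_self_eq_norm_sq_to_K] at h1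
  simp only [Complex.coe_algebraMap] at h1
  have h3 : ‖(f c : K →L[ℂ] K) v‖ ^ 2 = ‖b‖ ^ 2 * ‖v‖ ^ 2 - ‖(f b : K →L[ℂ] K) v‖ ^ 2 := by
    exact_mod_cast h1
  change ‖(f b : K →L[ℂ] K) v‖ ^ 2 ≤ (‖b‖ * ‖v‖) ^ 2
  rw [mul_pow]
  linarith [sq_nonneg ‖(f c : K →L[ℂ] K) v‖]

theorem IsFaithfulNormalTrace.norm_le (hτ : IsFaithfulNormalTrace B τ) (x : B) :
    ‖τ x‖ ≤ ‖x‖ := by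
  have h1 := norm_map_star_mul_sq_le hτ.nonneg 1 x
  rw [star_one, one_mul, one_mul, hτ.map_one, Complex.one_re, one_mul] at h1
  have h2 := (Complex.le_def.1 (hτ.le_norm (x := star x * x) (by simp))).1
  rw [Complex.ofReal_re] at h2
  have h3 : ‖star x * x‖ ≤ ‖x‖ ^ 2 :=
    (CStarRing.norm_star_mul_self (x := (x : H →L[ℂ] H))).trans (sq _).symm |>.le
  exact le_of_sq_le_sq (h1.trans (h2.trans h3)) (norm_nonneg _)

namespace BDist

variable {μ : BDist B}

theorem map_C_mul (μ : BDist B) (b : B) (P : NCPoly B) :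
    μ.toMap (NCPoly.C b * P) = b * μ.toMap P := by
  simpa using μ.bimodular b 1 P

theorem map_mul_C (μ : BDist B) (P : NCPoly B) (c : B) :
    μ.toMap (P * NCPoly.C c) = μ.toMap P * c := by
  simpa using μ.bimodular 1 c P

theorem map_C (h1 : μ.toMap 1 = 1) (b : B) : μ.toMap (NCPoly.C b) = b := by
  simpa [h1] using μ.map_C_mul b 1

theorem norm_one_le : ‖(1 : B)‖ ≤ 1 := ContinuousLinearMap.norm_id_le

theorem prod_norm_nonneg (l : List B) : 0 ≤ (l.map norm).prod :=
  List.prod_nonneg fun x hx => by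
    obtain ⟨b, -, rfl⟩ := List.mem_map.1 hx
    exact norm_nonneg b

/-- The constant in `sigmaZero` may be negative. -/
theorem expBounded_abs {M : ℝ} (h : μ ∈ expBounded B M) : μ ∈ expBounded B |M| := by
  intro l
  refine (h l).trans (mul_le_mul_of_nonneg_right ?_ (prod_norm_nonneg l))
  rw [← abs_pow]
  exact le_abs_self _

/-- Unital exponentially bounded maps are bounded on each polynomial, with growth controlled
by `M` under multiplication with powers of the indeterminate, uniformly in the map. -/
theorem exists_norm_mul_X_pow_le {M : ℝ} (hM : 0 ≤ M) (P : NCPoly B) :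
    ∃ K : ℝ, 0 ≤ K ∧ ∀ μ ∈ expBounded B M, μ.toMap 1 = 1 →
      ∀ k : ℕ, ‖μ.toMap (P * NCPoly.X ^ k)‖ ≤ K * M ^ k := by
  -- Only `≤`, since `H` may be zero here. The power `X ^ k` is the monomial with `k - 1` interior
  -- ones; `k = 0` is not of this form and is treated apart below.
  have hrep : ∀ k : ℕ, ((List.replicate k (1 : B)).map norm).prod ≤ 1 := fun k => by
    rw [List.map_replicate, List.prod_replicate]
    exact pow_le_one₀ (norm_nonneg _) norm_one_le
  induction NCPoly.span_isMonomial P using Submodule.span_induction with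
  | mem P hP =>
    obtain (b | ⟨b, l, c⟩) := hP
    · refine ⟨‖b‖, norm_nonneg _, fun μ hμ h1 k => ?_⟩
      rw [map_C_mul]
      refine (norm_mul_le _ _).trans ?_
      gcongr
      cases k with
      | zero => rw [pow_zero, pow_zero, h1]; exact norm_one_le
      | succ k =>
        rw [← NCPoly.monomial_replicate_one]
        refine (hμ _).trans ?_
        rw [List.length_replicate]
        exact mul_le_of_le_one_right (by positivity) (hrep k)
    · set K := M ^ (l.length + 1) * (l.map norm).prod with hK
      have hK0 : 0 ≤ K := mul_nonneg (by positivity) (prod_norm_nonneg l)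
      refine ⟨‖b‖ * (K * ‖c‖), by positivity, fun μ hμ h1 k => ?_⟩
      rw [mul_assoc, mul_assoc, map_C_mul, mul_assoc ‖b‖]
      refine (norm_mul_le _ _).trans ?_
      gcongr
      cases k with
      | zero =>
        rw [pow_zero, pow_zero, mul_one, mul_one, map_mul_C]
        refine (norm_mul_le _ _).trans ?_
        gcongr
        exact hμ l
      | succ k =>
        rw [← NCPoly.monomial_replicate_one, ← mul_assoc, NCPoly.monomial_mul_C_mul_monomial]
        refine (hμ _).trans ?_
        rw [List.map_append, List.map_cons, List.prod_append, List.prod_cons, List.length_append,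
          List.length_cons, List.length_replicate]
        calc M ^ (l.length + (k + 1) + 1) * ((l.map norm).prod *
              (‖c‖ * ((List.replicate k (1 : B)).map norm).prod))
            = K * ‖c‖ * M ^ (k + 1) * ((List.replicate k (1 : B)).map norm).prod := by
              rw [hK]; ring
          _ ≤ K * ‖c‖ * M ^ (k + 1) := mul_le_of_le_one_right (by positivity) (hrep k)
  | zero => exact ⟨0, le_rfl, fun μ _ _ k => by simp⟩
  | add P Q _ _ hP hQ =>
    obtain ⟨K, hK, h⟩ := hP
    obtain ⟨K', hK', h'⟩ := hQ
    refine ⟨K + K', by positivity, fun μ hμ h1 k => ?_⟩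
    rw [add_mul, map_add, add_mul]
    exact (norm_add_le _ _).trans (add_le_add (h μ hμ h1 k) (h' μ hμ h1 k))
  | smul z P _ hP =>
    obtain ⟨K, hK, h⟩ := hP
    refine ⟨‖z‖ * K, by positivity, fun μ hμ h1 k => ?_⟩
    rw [smul_mul_assoc, map_smul, norm_smul, mul_assoc]
    gcongr
    exact h μ hμ h1 k

theorem map_star_mul_self_nonneg (μ : BDist B) (P : NCPoly B) :
    (0 : H →L[ℂ] H) ≤ μ.toMap (star P * P) :=
  VonNeumannAlgebra.nonneg_of_inner fun ξ => by
    simpa using μ.completelyPositive 1 (fun _ => P) (fun _ => ξ)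

/-- The tracial state `τ ∘ μ` on polynomials. -/
noncomputable def traceState (hτ : IsFaithfulNormalTrace B τ) (hμ : μ ∈ sigmaZero B)
    (h1 : μ.toMap 1 = 1)
    (htr : ∀ P Q, τ (μ.toMap (P * Q)) = τ (μ.toMap (Q * P))) : BoundedTracialState (NCPoly B) where
  φ := τ ∘ₗ μ.toMap
  map_one := by rw [LinearMap.comp_apply, h1, hτ.map_one]
  nonneg P := hτ.nonneg_of_nonneg (μ.map_star_mul_self_nonneg P)
  tracial := htr
  bounded := by
    set φ : NCPoly B →ₗ[ℂ] ℂ := τ ∘ₗ μ.toMap with hφ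
    have hpos : ∀ P, 0 ≤ φ (star P * P) := fun P =>
      hτ.nonneg_of_nonneg (μ.map_star_mul_self_nonneg P)
    have hre : ∀ P, 0 ≤ (φ (star P * P)).re := fun P => (Complex.nonneg_iff.1 (hpos P)).1
    -- The sign of `C` is carried through the induction because the product step composes the two
    -- bounds.
    suffices h : ∀ P, ∃ C : ℝ, 0 ≤ C ∧ ∀ Q, (φ (star (P * Q) * (P * Q))).re ≤
        C * (φ (star Q * Q)).re from fun P => (h P).imp fun _ h => h.2
    intro P
    induction P using NCPoly.induction with
    | hC b =>
      refine ⟨‖b‖ ^ 2, by positivity, fun Q => ?_⟩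
      obtain ⟨c, hc⟩ := VonNeumannAlgebra.exists_norm_sq_sub b
      have h2 := hre (NCPoly.C c * Q)
      have h3 : ∀ x : B, star (NCPoly.C x * Q) * (NCPoly.C x * Q) =
          star Q * (NCPoly.C (star x * x) * Q) := fun x => by
        rw [star_mul, NCPoly.star_C, map_mul]; simp only [mul_assoc]
      rw [h3, hc, map_sub, map_smul, _root_.map_one, sub_mul, mul_sub, map_sub, smul_mul_assoc,
        one_mul, mul_smul_comm, map_smul, ← h3, Complex.sub_re, smul_eq_mul,
        Complex.re_ofReal_mul] at h2
      linarith
    | hX =>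
      obtain ⟨M, hM⟩ := hμ
      refine ⟨|M| ^ 2, by positivity, fun Q => ?_⟩
      -- The moments `φ(Q* X^(2k) Q)` are log-convex by Cauchy–Schwarz and, by traciality, equal
      -- `φ(Q Q* X^(2k))`, at most `K |M|^(2k)`. Hence the first ratio is at most `|M|²`,
      -- independently of `Q`.
      obtain ⟨K, hK, hb⟩ := exists_norm_mul_X_pow_le (abs_nonneg M) (Q * star Q)
      have hXk : ∀ j k : ℕ, star (NCPoly.X ^ j * Q) * (NCPoly.X ^ k * Q) =
          star Q * (NCPoly.X ^ (j + k) * Q) := fun j k => by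
        rw [star_mul, star_pow, NCPoly.star_X, pow_add]; simp only [mul_assoc]
      have := le_mul_of_logConvex (a := fun k => (φ (star (NCPoly.X ^ k * Q) *
        (NCPoly.X ^ k * Q))).re) (K := K) (r := |M| ^ 2) (fun k => hre _) (fun k => ?_)
        (by positivity) (fun k => ?_)
      · simpa using this
      · refine le_trans ?_ (norm_map_star_mul_sq_le hpos _ _)
        rw [hXk, hXk, show k + 1 + (k + 1) = k + (k + 2) by ring]
        rw [← sq_abs]
        gcongr
        exact Complex.abs_re_le_norm _
      · refine (Complex.re_le_norm _).trans ?_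
        rw [hXk, hφ, LinearMap.comp_apply, htr, mul_assoc, htr, ← two_mul, ← pow_mul]
        exact (hτ.norm_le _).trans (hb μ (expBounded_abs hM) h1 _)
    | hadd P P' hP hP' =>
      obtain ⟨C, hC, h⟩ := hP
      obtain ⟨C', hC', h'⟩ := hP'
      -- The constant comes from the parallelogram law.
      refine ⟨2 * C + 2 * C', by positivity, fun Q => ?_⟩
      have e : ∀ x y : NCPoly B, φ (star (x + y) * (x + y)) + φ (star (x - y) * (x - y)) =
          2 * φ (star x * x) + 2 * φ (star y * y) := fun x y => by
        simp only [star_add, star_sub, add_mul, mul_add, sub_mul, mul_sub, map_add, map_sub]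
        ring
      have e1 := congrArg Complex.re (e (P * Q) (P' * Q))
      simp only [Complex.add_re, Complex.mul_re, Complex.re_ofNat, Complex.im_ofNat, zero_mul,
        sub_zero] at e1
      rw [add_mul]
      linarith [h Q, h' Q, hre (P * Q - P' * Q)]
    | hmul P P' hP hP' =>
      obtain ⟨C, hC, h⟩ := hP
      obtain ⟨C', hC', h'⟩ := hP'
      refine ⟨C * C', by positivity, fun Q => ?_⟩
      rw [mul_assoc, mul_assoc]
      exact (h _).trans (mul_le_mul_of_nonneg_left (h' Q) hC)

end BDist

end distributions

/-- The inclusion of the coefficients as constant polynomials, as a *-homomorphism. -/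
noncomputable def NCPoly.starC {R : Type u} [Ring R] [Algebra ℂ R] [StarRing R]
    [StarModule ℂ R] : R →⋆ₐ[ℂ] NCPoly R :=
  { (NCPoly.C : R →ₐ[ℂ] NCPoly R) with map_star' := fun b => (NCPoly.star_C b).symm }

/-! ### Intrinsic description of `Σ₀^τ`, closedness and compactness -/

section distributions

open Filter

variable {H : Type u} [NormedAddCommGroup H] [InnerProductSpace ℂ H] [CompleteSpace H]
variable {B : VonNeumannAlgebra H} {τ : B →ₗ[ℂ] ℂ}

namespace BDist

/-- A *-homomorphism of von Neumann algebras converges ultraweakly as soon as it does so on a dense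
set of vectors. -/
theorem _root_.VonNeumannAlgebra.uwTendsto_starAlgHom {K : Type v} [NormedAddCommGroup K]
    [InnerProductSpace ℂ K] [CompleteSpace K] {A : VonNeumannAlgebra K} (f : B →⋆ₐ[ℂ] A)
    {ι : Type*} {v : ι → K} (hv : DenseRange v) {l : Filter B} {b : B} (hl : ∀ᶠ c in l, ‖c‖ ≤ 1)
    (h : ∀ i j, Tendsto (fun c => ⟪v j, (f c : K →L[ℂ] K) (v i)⟫_ℂ) l
      (𝓝 ⟪v j, (f b : K →L[ℂ] K) (v i)⟫_ℂ)) : A.UWTendsto f l (f b) := by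
  refine VonNeumannAlgebra.uwTendsto_of_ultrafilter fun F hF => ?_
  obtain ⟨y, -, hy⟩ := VonNeumannAlgebra.exists_uwTendsto_of_bounded (f := f) F (C := 1)
    ((hl.filter_mono hF).mono fun c hc => (VonNeumannAlgebra.norm_starAlgHom_le f c).trans hc)
  -- Images of contractions stay bounded, so a limit exists along the ultrafilter; the dense vectors
  -- identify it.
  have hyb : y = f b := by
    refine Subtype.ext (ContinuousLinearMap.ext fun x => congrFun (hv.equalizer
      (g := fun x => (y : K →L[ℂ] K) x) (h := fun x => (f b : K →L[ℂ] K) x)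
      (by fun_prop) (by fun_prop) (funext fun i => ?_)) x)
    refine ext_inner_left ℂ fun z => congrFun (hv.equalizer
      (g := fun z => ⟪z, (y : K →L[ℂ] K) (v i)⟫_ℂ)
      (h := fun z => ⟪z, (f b : K →L[ℂ] K) (v i)⟫_ℂ) (by fun_prop) (by fun_prop)
      (funext fun j => ?_)) z
    exact tendsto_nhds_unique (hy.inner (v i) (v j)) ((h i j).mono_left hF)
  rwa [← hyb]

/-- A cyclic tracial representation of polynomials that implements `τ ∘ μ` realizes `μ` as the
distribution of an element of a tracial W*-probability space. -/
theorem mem_sigmaTau_of_rep {μ : BDist B} (hτ : IsFaithfulNormalTrace B τ)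
    (hμ : μ ∈ sigmaZero B) (h1 : μ.toMap 1 = 1) {K : Type u} [NormedAddCommGroup K]
    [InnerProductSpace ℂ K] [CompleteSpace K] {A : VonNeumannAlgebra K} {τA : A →ₗ[ℂ] ℂ}
    (hA : IsFaithfulNormalTrace A τA) {Ω : K} (hΩ : ∀ x, τA x = ⟪Ω, (x : K →L[ℂ] K) Ω⟫_ℂ)
    (π : NCPoly B →⋆ₐ[ℂ] A) (hπ : ∀ P, τA (π P) = τ (μ.toMap P))
    (hdense : DenseRange fun P => (π P : K →L[ℂ] K) Ω) : μ ∈ sigmaTau B τ := by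
  obtain ⟨incl, hincl⟩ : ∃ incl : B →⋆ₐ[ℂ] A, ∀ b, incl b = π (NCPoly.C b) :=
    ⟨π.comp NCPoly.starC, fun _ => rfl⟩
  obtain ⟨E, hE, S, a, ha, hS⟩ := hτ.exists_tracialProbSpace hA hΩ incl
    (fun b => by rw [hincl, hπ, map_C h1]) (fun l b hl hb => by
      refine VonNeumannAlgebra.uwTendsto_starAlgHom incl hdense hl fun P Q => ?_
      -- Traciality collects `P` and `Q*` on one side of `c`, so each coefficient is a normal
      -- functional of `c`.
      have e : ∀ c : B, ⟪(π Q : K →L[ℂ] K) Ω, (incl c : K →L[ℂ] K) ((π P : K →L[ℂ] K) Ω)⟫_ℂ =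
          τ (μ.toMap (P * star Q) * c) := fun c => by
        rw [← map_mul_C, ← hπ, mul_assoc, map_mul π, hA.tracial, ← map_mul π, mul_assoc, map_mul π,
          map_star π, map_mul π, ← hincl, hΩ]
        change _ = ⟪Ω, (star (π Q : K →L[ℂ] K)) ((incl c : K →L[ℂ] K) ((π P : K →L[ℂ] K) Ω))⟫_ℂ
        rw [ContinuousLinearMap.star_eq_adjoint, ContinuousLinearMap.adjoint_inner_right]
      simp only [e]
      exact hτ.tendsto (hb.mul_left _))
  refine ⟨hμ, S, a (π NCPoly.X), ha _ ?_, fun P => ?_⟩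
  · rw [IsSelfAdjoint, ← map_star, NCPoly.star_X]
  · have heval : NCPoly.eval incl.toAlgHom (π NCPoly.X) P = π P := by
      induction P using NCPoly.induction with
      | hC b => exact (NCPoly.eval_C _ _ b).trans (hincl b)
      | hX => exact NCPoly.eval_X _ _
      | hadd P Q hP hQ => rw [map_add, map_add, hP, hQ]
      | hmul P Q hP hQ => rw [map_mul, map_mul, hP, hQ]
    rw [hS]
    refine hτ.eq_of_forall_mul fun b => ?_
    rw [heval, hE, hincl, ← map_mul, hπ, map_mul_C]

theorem mem_sigmaTau_of_tracial {μ : BDist B} (hτ : IsFaithfulNormalTrace B τ)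
    (hμ : μ ∈ sigmaZero B) (h1 : μ.toMap 1 = 1)
    (htr : ∀ P Q, τ (μ.toMap (P * Q)) = τ (μ.toMap (Q * P))) : μ ∈ sigmaTau B τ := by
  obtain ⟨s, hφ⟩ : ∃ s : BoundedTracialState (NCPoly B), ∀ P, s.φ P = τ (μ.toMap P) :=
    ⟨traceState hτ hμ h1 htr, fun _ => rfl⟩
  exact mem_sigmaTau_of_rep hτ hμ h1 s.isFaithfulNormalTrace s.trace_apply s.rep
    (fun P => (s.trace_rep P).trans (hφ P)) s.denseRange_rep

/-- The elements of `Σ₀^τ` are the unital maps in `Σ₀` whose composition with `τ` is tracial. -/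
theorem mem_sigmaTau_iff {μ : BDist B} (hτ : IsFaithfulNormalTrace B τ) :
    μ ∈ sigmaTau B τ ↔ μ ∈ sigmaZero B ∧ μ.toMap 1 = 1 ∧
      ∀ P Q, τ (μ.toMap (P * Q)) = τ (μ.toMap (Q * P)) := by
  refine ⟨fun ⟨hμ, S, a, _, h⟩ => ⟨hμ, ?_, fun P Q => ?_⟩,
    fun h => mem_sigmaTau_of_tracial hτ h.1 h.2.1 h.2.2⟩
  · rw [h, map_one, ← map_one S.incl, S.E_incl]
  · rw [h, h, S.trace_E, S.trace_E, map_mul, map_mul (NCPoly.eval _ _), S.isTrace.tracial]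

theorem tendsto_iff {ι : Type*} {f : ι → BDist B} {l : Filter ι} {μ : BDist B} :
    Tendsto f l (𝓝 μ) ↔ ∀ P, B.UWTendsto (fun i => (f i).toMap P) l (μ.toMap P) := by
  unfold VonNeumannAlgebra.UWTendsto
  rw [nhds_iInf]
  simp only [tendsto_iInf]
  refine forall_congr' fun P => ?_
  rw [@nhds_induced _ _ B.ultraweak, tendsto_comap_iff]
  rfl

/-- Both conditions equate quantities that are continuous in `μ`, by normality of `τ`. Exponential
boundedness of the limit is not claimed: closedness takes it from the ambient `Σ₀`, compactness from
the fixed `M`. -/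
theorem tracial_of_tendsto {ι : Type*} {l : Filter ι} [l.NeBot] {f : ι → BDist B} {μ : BDist B}
    (hτ : IsFaithfulNormalTrace B τ) (hf : Tendsto f l (𝓝 μ))
    (hl : ∀ᶠ i in l, f i ∈ sigmaTau B τ) :
    μ.toMap 1 = 1 ∧ ∀ P Q, τ (μ.toMap (P * Q)) = τ (μ.toMap (Q * P)) := by
  rw [tendsto_iff] at hf
  refine ⟨(hf 1).unique ((VonNeumannAlgebra.uwTendsto_const l 1).congr ?_), fun P Q => ?_⟩
  · filter_upwards [hl] with i hi using ((mem_sigmaTau_iff hτ).1 hi).2.1.symm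
  · refine tendsto_nhds_unique (hτ.tendsto (hf (P * Q)))
      ((hτ.tendsto (hf (Q * P))).congr' ?_)
    filter_upwards [hl] with i hi using (((mem_sigmaTau_iff hτ).1 hi).2.2 P Q).symm

theorem isClosed_sigmaTau (hτ : IsFaithfulNormalTrace B τ) :
    IsClosed {μ : sigmaZero B | (μ : BDist B) ∈ sigmaTau B τ} := by
  rw [isClosed_iff_ultrafilter]
  intro μ F hF hmem
  have h := tracial_of_tendsto hτ ((continuous_subtype_val.tendsto μ).mono_left hF) hmem
  exact (mem_sigmaTau_iff hτ).2 ⟨μ.2, h⟩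

/-- Unital maps in `Σ_{0,M}` converge along any ultrafilter. -/
theorem exists_tendsto_of_expBounded {M : ℝ} (hM : 0 ≤ M) (F : Ultrafilter (BDist B))
    (hF : ∀ᶠ μ in (F : Filter (BDist B)), μ ∈ expBounded B M ∧ μ.toMap 1 = 1) :
    ∃ μ ∈ expBounded B M, (F : Filter (BDist B)) ≤ 𝓝 μ := by
  have hlim : ∀ P : NCPoly B, ∃ b : B, B.UWTendsto (fun μ : BDist B => μ.toMap P) F b := by
    intro P
    obtain ⟨K, -, hK⟩ := exists_norm_mul_X_pow_le hM P
    obtain ⟨b, -, hb⟩ := VonNeumannAlgebra.exists_uwTendsto_of_bounded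
      (f := fun μ : BDist B => μ.toMap P) F (C := K)
      (hF.mono fun μ hμ => by simpa using hK μ hμ.1 hμ.2 0)
    exact ⟨b, hb⟩
  choose m hm using hlim
  let μ : BDist B :=
    { toMap :=
        { toFun := m
          map_add' := fun P Q => VonNeumannAlgebra.coe_ext_inner fun ξ η =>
            tendsto_nhds_unique ((hm (P + Q)).inner ξ η)
              ((((hm P).inner ξ η).add ((hm Q).inner ξ η)).congr fun ν => by
                rw [map_add, ← inner_add_right]; rfl) |>.trans (by
                  rw [← inner_add_right]; rfl)
          map_smul' := fun c P => VonNeumannAlgebra.coe_ext_inner fun ξ η =>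
            tendsto_nhds_unique ((hm (c • P)).inner ξ η)
              ((((hm P).inner ξ η).const_mul c).congr fun ν => by
                rw [map_smul, ← inner_smul_right]; rfl) |>.trans (by
                  rw [← inner_smul_right]; rfl) }
      bimodular := fun b c P => (hm _).unique
        ((((hm P).mul_left b).mul_right c).congr
          (Eventually.of_forall fun ν => (ν.bimodular b c P).symm))
      completelyPositive := fun n P ξ => by
        refine ge_of_tendsto' (x := (F : Filter (BDist B)))
          (tendsto_finsetSum _ fun i _ => tendsto_finsetSum _ fun j _ =>
            (hm (star (P i) * P j)).inner (ξ j) (ξ i)) fun ν => ?_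
        exact ν.completelyPositive n P ξ }
  refine ⟨μ, fun l => ?_, tendsto_iff.2 hm⟩
  -- Balls are ultraweakly compact and limits are unique, so the bound for each monomial passes to
  -- the limit.
  obtain ⟨b, hb, hbl⟩ := VonNeumannAlgebra.exists_uwTendsto_of_bounded
    (f := fun μ : BDist B => μ.toMap (NCPoly.monomial l)) F (hF.mono fun μ hμ => hμ.1 l)
  change ‖m (NCPoly.monomial l)‖ ≤ _
  rwa [(hm _).unique hbl]

theorem isCompact_sigmaTau_inter_expBounded (hτ : IsFaithfulNormalTrace B τ) {M : ℝ}
    (hM : 0 ≤ M) : IsCompact (sigmaTau B τ ∩ expBounded B M) := by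
  rw [isCompact_iff_ultrafilter_le_nhds]
  intro F hF
  rw [le_principal_iff] at hF
  obtain ⟨μ, hμ, hFμ⟩ := exists_tendsto_of_expBounded hM F (by
    filter_upwards [hF] with ν hν using ⟨hν.2, ((mem_sigmaTau_iff hτ).1 hν.1).2.1⟩)
  have h := tracial_of_tendsto (f := id) hτ hFμ (by filter_upwards [hF] with ν hν using hν.1)
  exact ⟨μ, ⟨(mem_sigmaTau_iff hτ).2 ⟨⟨M, hμ⟩, h⟩, hμ⟩, hFμ⟩

end BDist

end distributions

theorem corollary4p5 {H : Type u} [NormedAddCommGroup H] [InnerProductSpace ℂ H] [CompleteSpace H]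
    (B : VonNeumannAlgebra H) (τ : B →ₗ[ℂ] ℂ) (hτ : IsFaithfulNormalTrace B τ) :
    IsClosed {μ : BDist.sigmaZero B | (μ : BDist B) ∈ BDist.sigmaTau B τ} ∧
    ∀ M : ℝ, 0 < M → IsCompact (BDist.sigmaTau B τ ∩ BDist.expBounded B M) :=
  ⟨BDist.isClosed_sigmaTau hτ, fun _ hM => BDist.isCompact_sigmaTau_inter_expBounded hτ hM.le⟩
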